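/- **Setting.** Let $\hbar>0$ and let $\mathcal H=L^2(\mathbb R^n)$ carry the Schrödinger representation of the canonical commutation relations: $Q_j$ is multiplication by $y_j$, $P_j=-i\hbar\,\partial_j$, and $W(x,p)=\exp\{\frac i\hbar(p\cdot Q-x\cdot P)\}$ are the Weyl operators. Let $u,v\in\mathbb R^n$ be unit vectors with $u\cdot v=\cos\alpha$. For a state $\rho$ (positive operator of trace one), let $\mathsf Q_{u,\rho}$, $\mathsf P_{v,\rho}$ be the distributions in $\rho$ of the self-adjoint operators $Q_u=u\cdot Q$, $P_v=v\cdot P$. Put $\Omega=\begin{pmatrix}0&\hbar 1\\-\hbar 1&0\end{pmatrix}$. The state $\rho$ is *Gaussian* if $\mathrm{Tr}\{\rho W(-\Omega w)\}=\exp\{i\,w^T\mu-\frac12 w^TVw\}$ for all $w\in\mathbb R^{2n}$, for some $\mu\in\mathbb R^{2n}$ and some real matrix $V$ with $V+\frac i2\Omega\ge0$. A *Gaussian bi-observable* with parameters $(\mu,V,J)$, where $\mu\in\mathbb R^2$, $V$ is a real symmetric $2\times2$ matrix and $J$ is a real $2\times 2n$ matrix with $V\pm\frac i2J\Omega J^T\ge0$,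 is a positive operator valued measure $\mathsf M$ on $\mathbb R^2$ such that, for all $\kappa=(k,l)^T\in\mathbb R^2$, $\int e^{i(kx+lp)}\,\mathsf M(dx\,dp)=W(-\Omega J^T\kappa)\exp\{i\kappa^T\mu-\frac12\kappa^TV\kappa\}$. It is *$(u,v)$-covariant* if $W(x,p)\mathsf M(Z)W(x,p)^*=\mathsf M(Z+(u\cdot x,\,v\cdot p))$ for all Borel sets $Z\subseteq\mathbb R^2$ and all $x,p\in\mathbb R^n$. Let $\mathcal C^G_{u,v}$ be the set of the Gaussian $(u,v)$-covariant bi-observables, and let $\mathsf M_{1,\rho}$, $\mathsf M_{2,\rho}$ be the distributions in $\rho$ of the two marginals of $\mathsf M$. Write $\log=\log_2$, let $S(p\|q)=\int f\log(f/g)\in[0,+\infty]$ be the relative entropy of probabilities with densities $f$, $g$, and put $S(\rho,\mathsf M)=S(\mathsf Q_{u,\rho}\|\mathsf M_{1,\rho})+S(\mathsf P_{v,\rho}\|\mathsf M_{2,\rho})$ and $s(x)=\ln(1+x)-\frac{x}{1+x}$. **Theorem.** Let $\rho$ be a Gaussian state. Then $\mathrm{Var}(\mathsf Q_{u,\rho})>0$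 and $\mathrm{Var}(\mathsf P_{v,\rho})>0$, $$z_\rho:=\frac{\hbar|\cos\alpha|}{2\sqrt{\mathrm{Var}(\mathsf Q_{u,\rho})\,\mathrm{Var}(\mathsf P_{v,\rho})}}\in[0,1],$$ and, for every $\mathsf M\in\mathcal C^G_{u,v}$, $$S(\mathsf Q_{u,\rho}\|\mathsf M_{1,\rho})+S(\mathsf P_{v,\rho}\|\mathsf M_{2,\rho})\ \ge\ c_\rho(\alpha):=s(z_\rho)\log e ,$$ where $$c_\rho(\alpha)=(\log e)\Big\{\ln\Big(1+\tfrac{\hbar|\cos\alpha|}{2\sqrt{\mathrm{Var}(\mathsf Q_{u,\rho})\mathrm{Var}(\mathsf P_{v,\rho})}}\Big)-\tfrac{\hbar|\cos\alpha|}{\hbar|\cos\alpha|+2\sqrt{\mathrm{Var}(\mathsf Q_{u,\rho})\mathrm{Var}(\mathsf P_{v,\rho})}}\Big\}.$$ The bound is tight and the optimal measurement is unique: there is exactly one $\mathsf M_*\in\mathcal C^G_{u,v}$ with $S(\rho,\mathsf M_*)=c_\rho(\alpha)$. It has $J^{\mathsf M_*}=\begin{pmatrix}u^T&0\\0&v^T\end{pmatrix}$,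 and it is characterized within $\mathcal C^G_{u,v}$ by its parameters: $S(\rho,\mathsf M)=c_\rho(\alpha)$ if and only if $\mu^{\mathsf M}=0$, $V^{\mathsf M}_{12}=0$, $$V^{\mathsf M}_{11}=z_\rho\,\mathrm{Var}(\mathsf Q_{u,\rho})=\frac\hbar2\sqrt{\frac{\mathrm{Var}(\mathsf Q_{u,\rho})}{\mathrm{Var}(\mathsf P_{v,\rho})}}\,|\cos\alpha|,\qquad V^{\mathsf M}_{22}=z_\rho\,\mathrm{Var}(\mathsf P_{v,\rho})=\frac\hbar2\sqrt{\frac{\mathrm{Var}(\mathsf P_{v,\rho})}{\mathrm{Var}(\mathsf Q_{u,\rho})}}\,|\cos\alpha| .$$ -/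

import Mathlib

open MeasureTheory ProbabilityTheory
open scoped ENNReal ComplexOrder

noncomputable section

namespace MUR

/-! ### Trace and states -/

section General

variable {H : Type*} [NormedAddCommGroup H] [InnerProductSpace ℂ H] [CompleteSpace H]

/-- The index set of a fixed orthonormal (Hilbert) basis of `H`. -/
def basisSet (H : Type*) [NormedAddCommGroup H] [InnerProductSpace ℂ H] [CompleteSpace H] : Set H :=
  Classical.choose (exists_hilbertBasis ℂ H)

/-- A fixed orthonormal (Hilbert) basis of `H`, used to compute traces. -/
def basis (H : Type*) [NormedAddCommGroup H] [InnerProductSpace ℂ H] [CompleteSpace H] :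
    HilbertBasis (basisSet H) ℂ H :=
  Classical.choose (Classical.choose_spec (exists_hilbertBasis ℂ H))

/-- The trace `Tr T = ∑ᵢ ⟨eᵢ, T eᵢ⟩`. It is only applied to trace class operators, for which the sum
converges absolutely and does not depend on the orthonormal basis. -/
def trace (T : H →L[ℂ] H) : ℂ := ∑' i, inner ℂ (basis H i) (T (basis H i))

/-- A state (density operator, statistical operator) on `H`: a positive operator of trace one. -/
structure DensityOperator (H : Type*) [NormedAddCommGroup H] [InnerProductSpace ℂ H]
    [CompleteSpace H] where
  op : H →L[ℂ] H
  isPositive : op.IsPositive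
  hasSum_trace : HasSum (fun i => inner ℂ (basis H i) (op (basis H i))) 1

theorem exists_sqrt (ρ : DensityOperator H) :
    ∃ r : H →L[ℂ] H, IsSelfAdjoint r ∧ r * r = ρ.op := by
  have h0 : (0 : H →L[ℂ] H) ≤ ρ.op :=
    (ContinuousLinearMap.nonneg_iff_isPositive _).2 ρ.isPositive
  exact ⟨CFC.sqrt ρ.op, (CFC.sqrt_nonneg ρ.op).isSelfAdjoint, CFC.sqrt_mul_sqrt_self ρ.op h0⟩

theorem summable_normSq_inner (b : HilbertBasis (basisSet H) ℂ H) (x : H) :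
    HasSum (fun i => ‖inner ℂ x (b i)‖ ^ 2) (‖x‖ ^ 2) := by
  have h := b.hasSum_inner_mul_inner x x
  have h2 := Complex.reCLM.hasSum h
  have e : Complex.reCLM (inner ℂ x x) = ‖x‖ ^ 2 := by
    rw [inner_self_eq_norm_sq_to_K]
    simp [← Complex.ofReal_pow]
  rw [e] at h2
  refine h2.congr_fun ?_
  intro i
  rw [← inner_conj_symm (b i) x, RCLike.mul_conj]
  simp [← Complex.ofReal_pow]

/-- Cyclicity of the trace: `Tr(ρ A) = ∑ⱼ ⟨r eⱼ, A r eⱼ⟩` whenever `ρ = r²`, `r` self-adjoint. -/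
theorem hasSum_trace_mul (ρ : DensityOperator H) {r : H →L[ℂ] H} (hr : IsSelfAdjoint r)
    (hrr : r * r = ρ.op) (A : H →L[ℂ] H) :
    HasSum (fun j => inner ℂ (r (basis H j)) (A (r (basis H j)))) (trace (ρ.op * A)) := by
  classical
  set b := basis H with hb
  have hs : ∀ x y : H, inner ℂ (r x) y = inner ℂ x (r y) := fun x y => by
    conv_lhs => rw [← hr.adjoint_eq]
    rw [ContinuousLinearMap.adjoint_inner_left]
  have hn : ∀ j, (‖r (b j)‖ ^ 2 : ℝ) = (inner ℂ (b j) (ρ.op (b j)) : ℂ).re := by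
    intro j
    rw [← hrr, mul_apply_eq_comp, ← hs, inner_self_eq_norm_sq_to_K]
    simp [← Complex.ofReal_pow]
  have hsum : Summable (fun j => ‖r (b j)‖ ^ 2) := by
    simp_rw [hn]
    exact (Complex.reCLM.hasSum ρ.hasSum_trace).summable
  have hsum' : Summable (fun j => ‖A.adjoint (r (b j))‖ ^ 2) := by
    refine Summable.of_nonneg_of_le (fun _ => by positivity) (fun j => ?_)
      (hsum.mul_left (‖A.adjoint‖ ^ 2))
    rw [← mul_pow]
    gcongr
    exact A.adjoint.le_opNorm _
  have key : ∀ B : H →L[ℂ] H, Summable (fun j => ‖B (b j)‖ ^ 2) →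
      Summable (fun p : basisSet H × basisSet H => ‖inner ℂ (B (b p.1)) (b p.2)‖ ^ 2) := by
    intro B hB
    rw [summable_prod_of_nonneg (fun _ => by positivity)]
    refine ⟨fun j => (summable_normSq_inner b (B (b j))).summable, ?_⟩
    simp_rw [fun j => (summable_normSq_inner b (B (b j))).tsum_eq]
    exact hB
  have k1 := key (A.adjoint * r) hsum'
  have k2 := key r hsum
  -- the double series
  let F : basisSet H × basisSet H → ℂ := fun p =>
    inner ℂ (A.adjoint (r (b p.1))) (b p.2) * inner ℂ (b p.2) (r (b p.1))
  have hF : Summable F := by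
    refine Summable.of_norm_bounded (k1.add k2) (fun p => ?_)
    have e2 : ‖inner ℂ (b p.2) (r (b p.1))‖ = ‖inner ℂ (r (b p.1)) (b p.2)‖ := norm_inner_symm _ _
    simp only [F, norm_mul, e2, mul_apply_eq_comp]
    nlinarith [sq_nonneg (‖inner ℂ (A.adjoint (r (b p.1))) (b p.2)‖
      - ‖inner ℂ (r (b p.1)) (b p.2)‖), sq_nonneg ‖inner ℂ (A.adjoint (r (b p.1))) (b p.2)‖,
      sq_nonneg ‖inner ℂ (r (b p.1)) (b p.2)‖]
  have row : ∀ j, HasSum (fun i => F (j, i)) (inner ℂ (r (b j)) (A (r (b j)))) := by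
    intro j
    have := b.hasSum_inner_mul_inner (A.adjoint (r (b j))) (r (b j))
    rwa [ContinuousLinearMap.adjoint_inner_left] at this
  have col : ∀ i, HasSum (fun j => F (j, i)) (inner ℂ (b i) ((ρ.op * A) (b i))) := by
    intro i
    have := b.hasSum_inner_mul_inner (r (b i)) (r (A (b i)))
    rw [hs (b i), ← mul_apply_eq_comp r r, hrr] at this
    refine this.congr_fun (fun j => ?_)
    simp only [F]
    rw [ContinuousLinearMap.adjoint_inner_left, hs (b j) (A (b i)) |>.symm, ← hs (b i), mul_comm]
  have h1 : HasSum (fun j => inner ℂ (r (b j)) (A (r (b j)))) (∑' p, F p) :=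
    hF.hasSum.prod_fiberwise row
  have h2 : HasSum (fun i => inner ℂ (b i) ((ρ.op * A) (b i))) (∑' p, F p) := by
    have hF' : HasSum (fun p : basisSet H × basisSet H => F p.swap) (∑' p, F p) :=
      (Equiv.prodComm _ _).hasSum_iff.2 hF.hasSum
    exact hF'.prod_fiberwise col
  have h3 : trace (ρ.op * A) = ∑' p, F p := h2.tsum_eq
  rwa [h3]

/-! ### Positive operator valued measures -/

/-- A positive operator valued measure (observable) on the measurable space `Ω`, with values in the
bounded operators on `H`. As for Mathlib's vector measures, non-measurable sets get the value `0`,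
so that two observables are equal iff they agree on the measurable sets. -/
@[ext]
structure POVM (Ω : Type*) [MeasurableSpace Ω] (H : Type*) [NormedAddCommGroup H]
    [InnerProductSpace ℂ H] [CompleteSpace H] where
  toFun : Set Ω → H →L[ℂ] H
  isPositive : ∀ Z, (toFun Z).IsPositive
  map_univ : toFun Set.univ = 1
  not_measurable : ∀ Z, ¬ MeasurableSet Z → toFun Z = 0
  hasSum_iUnion : ∀ Z : ℕ → Set Ω, (∀ i, MeasurableSet (Z i)) →
    Pairwise (fun i j => Disjoint (Z i) (Z j)) →
    ∀ φ ψ : H, HasSum (fun i => inner ℂ φ (toFun (Z i) ψ)) (inner ℂ φ (toFun (⋃ i, Z i) ψ))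

namespace POVM

variable {Ω Ω' : Type*} [MeasurableSpace Ω] [MeasurableSpace Ω']

theorem map_empty (M : POVM Ω H) : M.toFun ∅ = 0 := by
  have h := M.hasSum_iUnion (fun _ => ∅) (fun _ => MeasurableSet.empty)
    (fun _ _ _ => Set.disjoint_empty _)
  ext ψ
  refine ext_inner_left ℂ fun φ => ?_
  have h2 := (h φ ψ).summable.tendsto_atTop_zero
  have := tendsto_nhds_unique h2 tendsto_const_nhds
  simpa using this.symm

/-- The positive measure `Z ↦ ⟨ψ, M(Z) ψ⟩`. -/
def vecMeasure (M : POVM Ω H) (ψ : H) : Measure Ω :=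
  Measure.ofMeasurable (fun Z _ => ENNReal.ofReal (inner ℂ ψ (M.toFun Z ψ) : ℂ).re)
    (by simp [M.map_empty])
    (by
      intro Z hZ hd
      have h := Complex.reCLM.hasSum (M.hasSum_iUnion Z hZ hd ψ ψ)
      have hnn : ∀ i, 0 ≤ (inner ℂ ψ (M.toFun (Z i) ψ) : ℂ).re := fun i =>
        (M.isPositive (Z i)).re_inner_nonneg_right ψ
      rw [← ENNReal.ofReal_tsum_of_nonneg hnn h.summable]
      exact congrArg _ h.tsum_eq.symm)

theorem vecMeasure_apply (M : POVM Ω H) (ψ : H) {Z : Set Ω} (hZ : MeasurableSet Z) :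
    M.vecMeasure ψ Z = ENNReal.ofReal (inner ℂ ψ (M.toFun Z ψ) : ℂ).re :=
  Measure.ofMeasurable_apply Z hZ

theorem ofReal_trace (M : POVM Ω H) (ρ : DensityOperator H) {r : H →L[ℂ] H} (hr : IsSelfAdjoint r)
    (hrr : r * r = ρ.op) {Z : Set Ω} (hZ : MeasurableSet Z) :
    ENNReal.ofReal (trace (ρ.op * M.toFun Z)).re = ∑' j, M.vecMeasure (r (basis H j)) Z := by
  have h := Complex.reCLM.hasSum (hasSum_trace_mul ρ hr hrr (M.toFun Z))
  simp_rw [vecMeasure_apply M _ hZ]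
  have hnn : ∀ j, 0 ≤ (inner ℂ (r (basis H j)) (M.toFun Z (r (basis H j))) : ℂ).re := fun j =>
    (M.isPositive Z).re_inner_nonneg_right _
  rw [← ENNReal.ofReal_tsum_of_nonneg hnn h.summable]
  exact congrArg _ h.tsum_eq.symm

/-- The distribution `M_ρ(Z) = Tr{ρ M(Z)}` of the observable `M` in the state `ρ`. -/
def dist (M : POVM Ω H) (ρ : DensityOperator H) : Measure Ω :=
  Measure.ofMeasurable (fun Z _ => ENNReal.ofReal (trace (ρ.op * M.toFun Z)).re)
    (by simp [M.map_empty, trace])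
    (by
      intro Z hZ hd
      obtain ⟨r, hr, hrr⟩ := exists_sqrt ρ
      simp_rw [M.ofReal_trace ρ hr hrr (MeasurableSet.iUnion hZ)]
      rw [tsum_congr fun i => M.ofReal_trace ρ hr hrr (hZ i), ENNReal.tsum_comm]
      exact tsum_congr fun j => measure_iUnion hd hZ)

theorem dist_apply (M : POVM Ω H) (ρ : DensityOperator H) {Z : Set Ω} (hZ : MeasurableSet Z) :
    M.dist ρ Z = ENNReal.ofReal (trace (ρ.op * M.toFun Z)).re :=
  Measure.ofMeasurable_apply Z hZ

open Classical in
/-- The image of an observable under a measurable map `f` of the outcome spaces: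
`A ↦ M(f⁻¹ A)`. -/
def map (M : POVM Ω H) (f : Ω → Ω') (hf : Measurable f) : POVM Ω' H where
  toFun A := if MeasurableSet A then M.toFun (f ⁻¹' A) else 0
  isPositive A := by
    split_ifs
    · exact M.isPositive _
    · exact ContinuousLinearMap.isPositive_zero
  map_univ := by simp [M.map_univ]
  not_measurable A hA := if_neg hA
  hasSum_iUnion Z hZ hd φ ψ := by
    simp only [hZ, MeasurableSet.iUnion hZ, if_true, Set.preimage_iUnion]
    exact M.hasSum_iUnion _ (fun i => hf (hZ i)) (fun i j hij => (hd hij).preimage f) φ ψ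

/-- The first marginal `M₁(A) = M(A × ℝ)` of a bi-observable. -/
def fst (M : POVM (ℝ × ℝ) H) : POVM ℝ H := M.map Prod.fst measurable_fst

/-- The second marginal `M₂(B) = M(ℝ × B)` of a bi-observable. -/
def snd (M : POVM (ℝ × ℝ) H) : POVM ℝ H := M.map Prod.snd measurable_snd

/-- The observable `A ↦ U* M(A) U`, for a unitary operator `U`. -/
def unitaryConj (M : POVM Ω H) (U : H ≃ₗᵢ[ℂ] H) : POVM Ω H where
  toFun A := U.symm.toContinuousLinearEquiv.toContinuousLinearMap ∘L M.toFun A ∘L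
    U.toContinuousLinearEquiv.toContinuousLinearMap
  isPositive A := by
    refine (ContinuousLinearMap.isPositive_iff_complex _).2 fun x => ?_
    have := (ContinuousLinearMap.isPositive_iff_complex _).1 (M.isPositive A) (U x)
    have e : inner ℂ (U.symm (M.toFun A (U x))) x = inner ℂ (M.toFun A (U x)) (U x) := by
      rw [← U.inner_map_map, U.apply_symm_apply]
    simpa [e] using this
  map_univ := by
    ext1 x
    simp [M.map_univ]
  not_measurable A hA := by
    ext1 x
    simp [M.not_measurable A hA]
  hasSum_iUnion Z hZ hd φ ψ := by
    have e : ∀ y : H, inner ℂ φ (U.symm y) = inner ℂ (U φ) y := fun y => by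
      rw [← U.inner_map_map, U.apply_symm_apply]
    have := M.hasSum_iUnion Z hZ hd (U φ) (U ψ)
    simpa [e] using this

/-- `T` is the value at `(k, l)` of the characteristic function of the bi-observable `M`, that is,
`T = ∫ exp(i(k x + l p)) M(dx dp)` as a weak operator integral. (On a complex Hilbert space, an
operator is determined by its quadratic form.) -/
def HasCharFunAt (M : POVM (ℝ × ℝ) H) (k l : ℝ) (T : H →L[ℂ] H) : Prop :=
  ∀ ψ : H, ∫ z : ℝ × ℝ, Complex.exp (Complex.I * ((k * z.1 + l * z.2 : ℝ) : ℂ)) ∂(M.vecMeasure ψ)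
    = inner ℂ ψ (T ψ)

end POVM

end General

/-! ### Position, momentum and Weyl operators in the Schrödinger representation -/

/-- The configuration space `ℝⁿ`. -/
abbrev Space (n : ℕ) : Type := EuclideanSpace ℝ (Fin n)

/-- The Hilbert space `L²(ℝⁿ)`. -/
abbrev WaveSpace (n : ℕ) : Type := Lp ℂ 2 (volume : Measure (Space n))

open Classical in
/-- Multiplication by an (essentially) bounded measurable function on `L²(ℝⁿ)`
(and `0` if `m` is not such a function). -/
def mulOp {n : ℕ} (m : Space n → ℂ) : WaveSpace n →L[ℂ] WaveSpace n :=
  if h : MemLp m ∞ (volume : Measure (Space n)) then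
    (ContinuousLinearMap.mul ℂ ℂ).holderL (volume : Measure (Space n)) ∞ 2 2 (h.toLp m) else 0

theorem mulOp_coeFn {n : ℕ} {m : Space n → ℂ} (h : MemLp m ∞ (volume : Measure (Space n)))
    (ψ : WaveSpace n) : mulOp m ψ =ᵐ[volume] fun y => m y * ψ y := by
  rw [mulOp, dif_pos h, ContinuousLinearMap.holderL_apply_apply]
  filter_upwards [ContinuousLinearMap.coeFn_holder (r := 2) (ContinuousLinearMap.mul ℂ ℂ)
    (h.toLp m) ψ, h.coeFn_toLp] with y h1 h2
  rw [h1, h2]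
  rfl

/-- The indicator function of `A`, with values in `ℂ`. -/
def ind {X : Type*} (A : Set X) : X → ℂ := A.indicator 1

theorem memLp_ind {n : ℕ} {A : Set (Space n)} (hA : MeasurableSet A) :
    MemLp (ind A) ∞ (volume : Measure (Space n)) := by
  refine memLp_top_of_bound ((measurable_const.indicator hA).aestronglyMeasurable) 1 ?_
  refine Filter.Eventually.of_forall fun x => ?_
  by_cases hx : x ∈ A <;> simp [ind, hx]

theorem inner_mulOp_ind {n : ℕ} {A : Set (Space n)} (hA : MeasurableSet A) (φ ψ : WaveSpace n) :
    inner ℂ φ (mulOp (ind A) ψ) = ∫ y in A, inner ℂ (φ y) (ψ y) := by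
  rw [L2.inner_def, ← integral_indicator hA]
  refine integral_congr_ae ?_
  filter_upwards [mulOp_coeFn (memLp_ind hA) ψ] with y hy
  rw [hy]
  by_cases hx : y ∈ A <;> simp [ind, hx]

open Classical in
/-- The spectral measure (pvm) on `L²(ℝⁿ)` of the operator of multiplication by the real function
`f`: the projection associated to `A` is the multiplication by the indicator function of
`f⁻¹ A`. -/
def multiplicationPVM {n : ℕ} (f : Space n → ℝ) (hf : Measurable f) : POVM ℝ (WaveSpace n) where
  toFun A := if MeasurableSet A then mulOp (ind (f ⁻¹' A)) else 0
  isPositive A := by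
    split_ifs with hA
    · refine (ContinuousLinearMap.isPositive_iff_complex _).2 fun ψ => ?_
      have e : inner ℂ (mulOp (ind (f ⁻¹' A)) ψ) ψ
          = ((∫ y in f ⁻¹' A, ‖ψ y‖ ^ 2 : ℝ) : ℂ) := by
        rw [← inner_conj_symm, inner_mulOp_ind (hf hA), ← integral_conj, ← integral_complex_ofReal]
        congr 1 with y
        simp [inner_self_eq_norm_sq_to_K]
      rw [e]
      refine ⟨by simp, ?_⟩
      simpa using integral_nonneg fun y => by positivity
    · exact ContinuousLinearMap.isPositive_zero
  map_univ := by
    rw [if_pos MeasurableSet.univ]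
    ext1 ψ
    apply Lp.ext
    filter_upwards [mulOp_coeFn (memLp_ind (n := n) (hf MeasurableSet.univ)) ψ] with y hy
    rw [hy]
    simp [ind]
  not_measurable A hA := if_neg hA
  hasSum_iUnion Z hZ hd φ ψ := by
    simp only [hZ, MeasurableSet.iUnion hZ, if_true, Set.preimage_iUnion]
    simp_rw [fun i => inner_mulOp_ind (hf (hZ i)) φ ψ]
    rw [inner_mulOp_ind (MeasurableSet.iUnion fun i => hf (hZ i))]
    exact hasSum_integral_iUnion (fun i => hf (hZ i)) (fun i j hij => (hd hij).preimage f)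
      (L2.integrable_inner φ ψ).integrableOn

/-- The pvm of the position `Q_u = u · Q` along `u`, where `(Qⱼψ)(y) = yⱼ ψ(y)`. -/
def positionPVM {n : ℕ} (u : Space n) : POVM ℝ (WaveSpace n) :=
  multiplicationPVM (fun y => inner ℝ u y) (by fun_prop)

/-- The pvm of the momentum `P_v = v · P` along `v`, where `Pⱼ = -iℏ ∂ⱼ`: with the Fourier transform
`(𝓕 ψ)(ξ) = ∫ exp(-2πi y·ξ) ψ(y) dy`, the operator `P_v` is `𝓕* (2πℏ v·ξ) 𝓕`. -/
def momentumPVM {n : ℕ} (ℏ : ℝ) (v : Space n) : POVM ℝ (WaveSpace n) :=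
  (multiplicationPVM (fun ξ => 2 * Real.pi * ℏ * inner ℝ v ξ) (by fun_prop)).unitaryConj
    (Lp.fourierTransformₗᵢ (Space n) ℂ)

/-- The Weyl operator `W(x, p) = exp{(i/ℏ)(p·Q - x·P)}`, that is,
`(W(x, p) ψ)(y) = exp{(i/ℏ)(p·y - p·x/2)} ψ(y - x)`. -/
def weyl {n : ℕ} (ℏ : ℝ) (x p : Space n) : WaveSpace n →L[ℂ] WaveSpace n :=
  mulOp (fun y => Complex.exp (Complex.I * (((inner ℝ p y - inner ℝ p x / 2) / ℏ : ℝ) : ℂ))) ∘L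
    (Lp.compMeasurePreservingₗᵢ ℂ (fun y : Space n => y - x)
      (measurePreserving_sub_right volume x)).toContinuousLinearMap

/-- The Weyl operator at the block vector `w = (x, p)` of the phase-space. -/
def weylVec {n : ℕ} (ℏ : ℝ) (w : Fin n ⊕ Fin n → ℝ) : WaveSpace n →L[ℂ] WaveSpace n :=
  weyl ℏ (WithLp.toLp 2 fun j => w (Sum.inl j)) (WithLp.toLp 2 fun j => w (Sum.inr j))

/-- The matrix `Ω = [[0, ℏ 1], [-ℏ 1, 0]]`. -/
def Omega (n : ℕ) (ℏ : ℝ) : Matrix (Fin n ⊕ Fin n) (Fin n ⊕ Fin n) ℝ :=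
  Matrix.fromBlocks 0 (ℏ • 1) (-(ℏ • 1)) 0

/-- The complexification of a real matrix. -/
def toComplex {ι κ : Type*} (A : Matrix ι κ ℝ) : Matrix ι κ ℂ := A.map Complex.ofReal

/-! ### Gaussian states and Gaussian bi-observables -/

/-- `ρ` is a Gaussian state: for some `μ` and some real `V` with `V + (i/2) Ω ≥ 0`, the
characteristic function of `ρ` is `Tr{ρ W(-Ω w)} = exp{i w·μ - w·V w / 2}`. -/
def IsGaussianState {n : ℕ} (ℏ : ℝ) (ρ : DensityOperator (WaveSpace n)) : Prop :=
  ∃ (μ : Fin n ⊕ Fin n → ℝ) (V : Matrix (Fin n ⊕ Fin n) (Fin n ⊕ Fin n) ℝ),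
    (toComplex V + (Complex.I / 2) • toComplex (Omega n ℏ)).PosSemidef ∧
    ∀ w : Fin n ⊕ Fin n → ℝ,
      trace (ρ.op * weylVec ℏ (-(Omega n ℏ).mulVec w)) =
        Complex.exp (Complex.I * ((w ⬝ᵥ μ : ℝ) : ℂ) - (((w ⬝ᵥ V.mulVec w) / 2 : ℝ) : ℂ))

/-- `M` is a Gaussian bi-observable on `ℝ × ℝ` with parameters `(μ, V, J)`: its characteristic
function at `(k, l)` is `W(-Ω Jᵀ (k, l)) exp{i (k, l)·μ - (k, l)·V (k, l) / 2}`, where `V` is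
symmetric and `V ± (i/2) J Ω Jᵀ ≥ 0`. -/
structure HasGaussianParams {n : ℕ} (ℏ : ℝ) (M : POVM (ℝ × ℝ) (WaveSpace n)) (μ : Fin 2 → ℝ)
    (V : Matrix (Fin 2) (Fin 2) ℝ) (J : Matrix (Fin 2) (Fin n ⊕ Fin n) ℝ) : Prop where
  symm : V.IsSymm
  posSemidef_add : (toComplex V +
    (Complex.I / 2) • toComplex (J * Omega n ℏ * J.transpose)).PosSemidef
  posSemidef_sub : (toComplex V -
    (Complex.I / 2) • toComplex (J * Omega n ℏ * J.transpose)).PosSemidef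
  hasCharFunAt : ∀ k l : ℝ, M.HasCharFunAt k l
    (Complex.exp (Complex.I * ((![k, l] ⬝ᵥ μ : ℝ) : ℂ)
        - (((![k, l] ⬝ᵥ V.mulVec ![k, l]) / 2 : ℝ) : ℂ)) •
      weylVec ℏ (-(Omega n ℏ).mulVec (J.transpose.mulVec ![k, l])))

/-- `M` is `(u, v)`-covariant: `W(x, p) M(Z) W(x, p)* = M(Z + (u·x, v·p))`. -/
def IsCovariant {n : ℕ} (ℏ : ℝ) (u v : Space n) (M : POVM (ℝ × ℝ) (WaveSpace n)) : Prop :=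
  ∀ Z : Set (ℝ × ℝ), MeasurableSet Z → ∀ x p : Space n,
    weyl ℏ x p * M.toFun Z * (weyl ℏ x p).adjoint =
      M.toFun ((fun z => z + (inner ℝ u x, inner ℝ v p)) '' Z)

/-- The class of the Gaussian `(u, v)`-covariant bi-observables. -/
def GaussianCovariant {n : ℕ} (ℏ : ℝ) (u v : Space n) : Set (POVM (ℝ × ℝ) (WaveSpace n)) :=
  {M | IsCovariant ℏ u v M ∧ ∃ μ V J, HasGaussianParams ℏ M μ V J}

/-- The `2 × 2n` matrix `J = [[uᵀ, 0ᵀ], [0ᵀ, vᵀ]]`. -/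
def covMatrix {n : ℕ} (u v : Space n) : Matrix (Fin 2) (Fin n ⊕ Fin n) ℝ :=
  Matrix.of ![Sum.elim (fun j => u j) (fun _ => 0), Sum.elim (fun _ => 0) (fun j => v j)]

/-! ### Relative entropy and error function -/

/-- The number `log e`, where `log` is the logarithm in base two. -/
def logE : ℝ := Real.logb 2 (Real.exp 1)

/-- The relative entropy `S(p‖q) = ∫ f log₂(f/g)` in bits of the probability `p` (with density `f`)
with respect to the probability `q` (with density `g`), with values in `[0, +∞]`. -/
def relEntropy {Ω : Type*} [MeasurableSpace Ω] (p q : Measure Ω) : ℝ≥0∞ :=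
  ENNReal.ofReal logE * InformationTheory.klDiv p q

/-- The error function `S(ρ, M) = S(Q_{u,ρ}‖M_{1,ρ}) + S(P_{v,ρ}‖M_{2,ρ})`. -/
def errorFunction {n : ℕ} (ℏ : ℝ) (u v : Space n) (ρ : DensityOperator (WaveSpace n))
    (M : POVM (ℝ × ℝ) (WaveSpace n)) : ℝ≥0∞ :=
  relEntropy ((positionPVM u).dist ρ) (M.fst.dist ρ) +
    relEntropy ((momentumPVM ℏ v).dist ρ) (M.snd.dist ρ)

/-- The function `s(x) = ln(1 + x) - x / (1 + x)`. -/
def sFun (x : ℝ) : ℝ := Real.log (1 + x) - x / (1 + x)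

/-- `Var(Q_{u,ρ})`, the variance of the distribution of the position along `u`. -/
def varQ {n : ℕ} (u : Space n) (ρ : DensityOperator (WaveSpace n)) : ℝ :=
  variance id ((positionPVM u).dist ρ)

/-- `Var(P_{v,ρ})`, the variance of the distribution of the momentum along `v`. -/
def varP {n : ℕ} (ℏ : ℝ) (v : Space n) (ρ : DensityOperator (WaveSpace n)) : ℝ :=
  variance id ((momentumPVM ℏ v).dist ρ)

/-- `z_ρ = ℏ |cos α| / (2 √(Var(Q_{u,ρ}) Var(P_{v,ρ})))`. -/
def zRho {n : ℕ} (ℏ : ℝ) (u v : Space n) (α : ℝ) (ρ : DensityOperator (WaveSpace n)) : ℝ :=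
  ℏ * |Real.cos α| / (2 * √(varQ u ρ * varP ℏ v ρ))

/-- The lower bound `c_ρ(α) = s(z_ρ) log e`. -/
def cRho {n : ℕ} (ℏ : ℝ) (u v : Space n) (α : ℝ) (ρ : DensityOperator (WaveSpace n)) : ℝ :=
  sFun (zRho ℏ u v α ρ) * logE

end MUR

end

open MUR

/-! ### Reduction to Gaussian marginals, minimization over the noise, and construction of the
minimizer. -/

noncomputable section

namespace MUR

section

/-! ### Phase multiplications, translations and the Fourier transform -/

variable {n : ℕ}

/-! The problem reduces to an elementary minimization over two noise variances. Conjugating a Weyl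
operator by another one produces a phase; comparing this phase with the one produced by translating
outcomes shows that covariance leaves no freedom in `J` (`HasGaussianParams.eq_covMatrix`). The
characteristic function of each marginal in `ρ` is then that of the sharp position or momentum
distribution times a Gaussian factor. Both are Gaussian, so measuring shifts the means by `μ` and
adds the diagonal entries of `V` to the variances. The relative entropies become explicit: with `x`,
`y` the ratios of added to sharp variance, the error is `logE / 2` times `s(x) + s(y)` plus
nonnegative terms that vanish only for `μ = 0` (`HasGaussianParams.errorFunction_eq`).

Positivity of the noise matrix gives, through its determinant, `x y ≥ z²`
(`HasGaussianParams.noise`). At a fixed product the sum `s(x) + s(y)` is smallest exactly when `x =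
y`, and `s` is strictly increasing, so the minimum is `2 s(z)`, attained only at `x = y = z`
(`two_mul_sFun_le`). There the determinant inequality is saturated, so the off-diagonal noise
vanishes too.

For existence, one auxiliary degree of freedom in its vacuum state is adjoined. The vectors `u`, `v`
are extended to orthogonal vectors `(a, u)`, `(b, v)` of `ℝⁿ⁺¹`; position along the first commutes
with momentum along the second, so the two can be measured jointly, after an isometry made of
quadratic phases and Fourier transforms (`phaseOp_chirpIso`). The vacuum supplies exactly the
required noise (`hasCharFunAt_smearedPOVM`). Uniqueness holds because a bi-observable is determined
by its characteristic function (`POVM.ext_of_hasCharFunAt`). -/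

/-- Multiplication by `exp(i f)` for a real function `f`. -/
def phaseOp (f : Space n → ℝ) : WaveSpace n →L[ℂ] WaveSpace n :=
  mulOp fun y => Complex.exp (Complex.I * (f y : ℂ))

/-- Translation `(T_a ψ)(y) = ψ(y - a)`. -/
def shiftOp (a : Space n) : WaveSpace n →ₗᵢ[ℂ] WaveSpace n :=
  Lp.compMeasurePreservingₗᵢ ℂ (fun y : Space n => y - a) (measurePreserving_sub_right volume a)

theorem norm_exp_I_mul_ofReal (t : ℝ) : ‖Complex.exp (Complex.I * (t : ℂ))‖ = 1 := by
  rw [mul_comm]; exact Complex.norm_exp_ofReal_mul_I t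

theorem memLp_phase {f : Space n → ℝ} (hf : Measurable f) :
    MemLp (fun y => Complex.exp (Complex.I * (f y : ℂ))) ∞ (volume : Measure (Space n)) := by
  refine memLp_top_of_bound (by fun_prop) 1 (Filter.Eventually.of_forall fun y => ?_)
  rw [norm_exp_I_mul_ofReal]

theorem phaseOp_coeFn {f : Space n → ℝ} (hf : Measurable f) (ψ : WaveSpace n) :
    phaseOp f ψ =ᵐ[volume] fun y => Complex.exp (Complex.I * (f y : ℂ)) * ψ y :=
  mulOp_coeFn (memLp_phase hf) ψ

theorem shiftOp_coeFn (a : Space n) (ψ : WaveSpace n) :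
    shiftOp a ψ =ᵐ[volume] fun y => ψ (y - a) :=
  Lp.coeFn_compMeasurePreserving ψ (measurePreserving_sub_right volume a)

theorem phaseOp_phaseOp {f g : Space n → ℝ} (hf : Measurable f) (hg : Measurable g)
    (ψ : WaveSpace n) : phaseOp f (phaseOp g ψ) = phaseOp (fun y => f y + g y) ψ := by
  apply Lp.ext
  filter_upwards [phaseOp_coeFn hf (phaseOp g ψ), phaseOp_coeFn hg ψ,
    phaseOp_coeFn (hf.add hg) ψ] with y h1 h2 h3
  rw [h1, h2, ← mul_assoc, ← Complex.exp_add]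
  refine Eq.trans ?_ h3.symm
  congr 2
  simp; ring

theorem shiftOp_phaseOp {f : Space n → ℝ} (hf : Measurable f) (a : Space n) (ψ : WaveSpace n) :
    shiftOp a (phaseOp f ψ) = phaseOp (fun y => f (y - a)) (shiftOp a ψ) := by
  apply Lp.ext
  have hf' : Measurable fun y => f (y - a) := hf.comp (measurable_sub_const a)
  filter_upwards [shiftOp_coeFn a (phaseOp f ψ), phaseOp_coeFn hf' (shiftOp a ψ),
    shiftOp_coeFn a ψ, (measurePreserving_sub_right volume a).quasiMeasurePreserving.ae
      (phaseOp_coeFn hf ψ)] with y h1 h2 h3 h4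
  rw [h1, h2, h3, h4]

theorem shiftOp_shiftOp (a b : Space n) (ψ : WaveSpace n) :
    shiftOp a (shiftOp b ψ) = shiftOp (a + b) ψ := by
  apply Lp.ext
  filter_upwards [shiftOp_coeFn a (shiftOp b ψ), shiftOp_coeFn (a + b) ψ,
    (measurePreserving_sub_right volume a).quasiMeasurePreserving.ae
      (shiftOp_coeFn b ψ)] with y h1 h2 h3
  rw [h1, h2, h3, sub_sub]

theorem phaseOp_const (c : ℝ) (ψ : WaveSpace n) :
    phaseOp (fun _ => c) ψ = Complex.exp (Complex.I * (c : ℂ)) • ψ := by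
  apply Lp.ext
  filter_upwards [phaseOp_coeFn (n := n) measurable_const ψ,
    Lp.coeFn_smul (Complex.exp (Complex.I * (c : ℂ))) ψ] with y h1 h2
  rw [h1, h2, Pi.smul_apply, smul_eq_mul]

theorem phaseOp_zero (ψ : WaveSpace n) : phaseOp (fun _ => 0) ψ = ψ := by
  rw [phaseOp_const]; simp

theorem shiftOp_zero (ψ : WaveSpace n) : shiftOp 0 ψ = ψ := by
  apply Lp.ext
  filter_upwards [shiftOp_coeFn 0 ψ] with y h1
  rw [h1, sub_zero]

theorem norm_phaseOp {f : Space n → ℝ} (hf : Measurable f) (ψ : WaveSpace n) :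
    ‖phaseOp f ψ‖ = ‖ψ‖ := by
  rw [Lp.norm_def, Lp.norm_def]
  congr 1
  refine eLpNorm_congr_norm_ae ?_
  filter_upwards [phaseOp_coeFn hf ψ] with y h
  rw [h, norm_mul, norm_exp_I_mul_ofReal, one_mul]

/-- Multiplication by `exp(i f)` as a linear isometry. -/
def phaseIso (f : Space n → ℝ) (hf : Measurable f) : WaveSpace n →ₗᵢ[ℂ] WaveSpace n where
  toLinearMap := (phaseOp f).toLinearMap
  norm_map' := norm_phaseOp hf

/-! ### Exchange of translations and linear phases by the Fourier transform. -/

/-- The Fourier transform on `L²(ℝⁿ)`. -/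
abbrev fourierL2 (n : ℕ) : WaveSpace n ≃ₗᵢ[ℂ] WaveSpace n := Lp.fourierTransformₗᵢ (Space n) ℂ

open FourierTransform in
theorem schwartz_fourier_compSubConst (a : Space n) (f : SchwartzMap (Space n) ℂ) (ξ : Space n) :
    𝓕 (SchwartzMap.compSubConstCLM ℂ a f) ξ =
      Complex.exp (Complex.I * ((-(2 * Real.pi * inner ℝ a ξ) : ℝ) : ℂ)) * 𝓕 f ξ := by
  rw [SchwartzMap.fourier_coe, SchwartzMap.fourier_coe, Real.fourier_eq', Real.fourier_eq',
    ← integral_const_mul, ← integral_add_right_eq_self _ a]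
  refine integral_congr_ae (Filter.Eventually.of_forall fun y => ?_)
  simp only [SchwartzMap.compSubConstCLM_apply, add_sub_cancel_right, smul_eq_mul, inner_add_left]
  rw [← mul_assoc, ← Complex.exp_add]
  congr 2
  push_cast; ring

open FourierTransform in
theorem schwartz_fourierInv_compSubConst (a : Space n) (f : SchwartzMap (Space n) ℂ)
    (ξ : Space n) : 𝓕⁻ (SchwartzMap.compSubConstCLM ℂ a f) ξ =
      Complex.exp (Complex.I * ((2 * Real.pi * inner ℝ a ξ : ℝ) : ℂ)) * 𝓕⁻ f ξ := by
  rw [SchwartzMap.fourierInv_coe, SchwartzMap.fourierInv_coe, Real.fourierInv_eq_fourier_neg,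
    Real.fourierInv_eq_fourier_neg, ← SchwartzMap.fourier_coe, ← SchwartzMap.fourier_coe,
    schwartz_fourier_compSubConst, inner_neg_right]
  simp

/-- Both sides are continuous in `ψ` and Schwartz functions are dense, so the pointwise identity
extends to `L²`. Keeping `G` abstract serves the Fourier transform and its inverse at once. -/
theorem l2_eq_phaseOp_of_schwartz (G : WaveSpace n ≃ₗᵢ[ℂ] WaveSpace n)
    (S : SchwartzMap (Space n) ℂ → SchwartzMap (Space n) ℂ) (hS : ∀ f, G (f.toLp 2) = (S f).toLp 2)
    (a : Space n) {θ : Space n → ℝ} (hθ : Measurable θ)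
    (h : ∀ f ξ, S (SchwartzMap.compSubConstCLM ℂ a f) ξ =
      Complex.exp (Complex.I * (θ ξ : ℂ)) * S f ξ) (ψ : WaveSpace n) :
    G (shiftOp a ψ) = phaseOp θ (G ψ) := by
  refine DenseRange.induction_on (p := fun ψ => G (shiftOp a ψ) = phaseOp θ (G ψ))
    (SchwartzMap.denseRange_toLpCLM (E := Space n) (F := ℂ)
    (p := 2) (μ := volume) ENNReal.ofNat_ne_top) ψ ?_ ?_
  · exact isClosed_eq (by fun_prop) (by fun_prop)
  intro f
  have h1 : shiftOp a (f.toLp 2) = (SchwartzMap.compSubConstCLM ℂ a f).toLp 2 := by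
    apply Lp.ext
    filter_upwards [shiftOp_coeFn a (f.toLp 2), (SchwartzMap.compSubConstCLM ℂ a f).coeFn_toLp 2,
      (measurePreserving_sub_right volume a).quasiMeasurePreserving.ae
        (f.coeFn_toLp 2 volume)] with y h1 h2 h3
    rw [h1, h2, h3]; rfl
  rw [SchwartzMap.toLpCLM_apply, h1, hS, hS]
  apply Lp.ext
  filter_upwards [phaseOp_coeFn hθ ((S f).toLp 2),
    (S (SchwartzMap.compSubConstCLM ℂ a f)).coeFn_toLp 2,
    (S f).coeFn_toLp 2] with y h1 h2 h3
  rw [h1, h2, h3, h]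

theorem fourierL2_shiftOp (a : Space n) (ψ : WaveSpace n) :
    fourierL2 n (shiftOp a ψ) =
      phaseOp (fun ξ => -(2 * Real.pi * inner ℝ a ξ)) (fourierL2 n ψ) :=
  l2_eq_phaseOp_of_schwartz _ _ SchwartzMap.toLp_fourier_eq a (by fun_prop)
    (schwartz_fourier_compSubConst a) ψ

/-- Follows from the translation rule for the inverse transform, applied to the vector `fourierL2 n
ψ`. -/
theorem fourierL2_phaseOp (a : Space n) (ψ : WaveSpace n) :
    fourierL2 n (phaseOp (fun y => 2 * Real.pi * inner ℝ a y) ψ) =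
      shiftOp a (fourierL2 n ψ) := by
  have h := l2_eq_phaseOp_of_schwartz (fourierL2 n).symm _ SchwartzMap.toLp_fourierInv_eq a
    (θ := fun y => 2 * Real.pi * inner ℝ a y) (by fun_prop)
    (schwartz_fourierInv_compSubConst a) (fourierL2 n ψ)
  rw [LinearIsometryEquiv.symm_apply_apply] at h
  rw [← h, LinearIsometryEquiv.apply_symm_apply]

/-! ### Weyl operators -/

theorem weyl_eq (ℏ : ℝ) (x p : Space n) (ψ : WaveSpace n) :
    weyl ℏ x p ψ = phaseOp (fun y => (inner ℝ p y - inner ℝ p x / 2) / ℏ) (shiftOp x ψ) := rfl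

theorem norm_weyl (ℏ : ℝ) (x p : Space n) (ψ : WaveSpace n) : ‖weyl ℏ x p ψ‖ = ‖ψ‖ := by
  rw [weyl_eq, norm_phaseOp (by fun_prop), LinearIsometry.norm_map]

theorem phaseOp_congr {f g : Space n → ℝ} (h : ∀ y, f y = g y) (ψ : WaveSpace n) :
    phaseOp f ψ = phaseOp g ψ := by rw [funext h]

theorem exp_smul_phaseOp {f : Space n → ℝ} (hf : Measurable f) (c : ℝ) (ψ : WaveSpace n) :
    Complex.exp (Complex.I * (c : ℂ)) • phaseOp f ψ = phaseOp (fun y => c + f y) ψ := by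
  rw [← phaseOp_const, phaseOp_phaseOp measurable_const hf]

/-- The canonical commutation relations in Weyl form. -/
theorem weyl_weyl_comm {ℏ : ℝ} (hℏ : ℏ ≠ 0) (x p x' p' : Space n) (ψ : WaveSpace n) :
    weyl ℏ x p (weyl ℏ x' p' ψ) =
      Complex.exp (Complex.I * (((inner ℝ p x' - inner ℝ p' x) / ℏ : ℝ) : ℂ)) •
        weyl ℏ x' p' (weyl ℏ x p ψ) := by
  simp only [weyl_eq]
  rw [shiftOp_phaseOp (by fun_prop), shiftOp_phaseOp (by fun_prop), shiftOp_shiftOp,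
    shiftOp_shiftOp, phaseOp_phaseOp (by fun_prop) (by fun_prop),
    phaseOp_phaseOp (by fun_prop) (by fun_prop), exp_smul_phaseOp (by fun_prop), add_comm x x']
  refine phaseOp_congr (fun y => ?_) _
  simp only [inner_sub_right]
  field_simp; ring

theorem weyl_neg_weyl (ℏ : ℝ) (x p : Space n) (ψ : WaveSpace n) :
    weyl ℏ (-x) (-p) (weyl ℏ x p ψ) = ψ := by
  simp only [weyl_eq]
  rw [shiftOp_phaseOp (by fun_prop), shiftOp_shiftOp,
    phaseOp_phaseOp (by fun_prop) (by fun_prop), neg_add_cancel, shiftOp_zero]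
  refine Eq.trans (phaseOp_congr (g := fun _ => 0) (fun y => ?_) _) (phaseOp_zero ψ)
  simp only [inner_sub_right, inner_neg_left, inner_neg_right]
  ring

theorem weyl_weyl_neg (ℏ : ℝ) (x p : Space n) (ψ : WaveSpace n) :
    weyl ℏ x p (weyl ℏ (-x) (-p) ψ) = ψ := by
  simpa using weyl_neg_weyl ℏ (-x) (-p) ψ

theorem inner_weyl_weyl (ℏ : ℝ) (x p : Space n) (φ ψ : WaveSpace n) :
    inner ℂ (weyl ℏ x p φ) (weyl ℏ x p ψ) = inner ℂ φ ψ :=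
  LinearIsometry.inner_map_map ⟨(weyl ℏ x p).toLinearMap, norm_weyl ℏ x p⟩ φ ψ

theorem weyl_adjoint (ℏ : ℝ) (x p : Space n) :
    (weyl ℏ x p).adjoint = weyl ℏ (-x) (-p) := by
  ext1 ψ
  refine ext_inner_left ℂ fun φ => ?_
  rw [ContinuousLinearMap.adjoint_inner_right, ← inner_weyl_weyl ℏ x p φ, weyl_weyl_neg]

end

section

/-! ### Distributions and characteristic functions of observables -/

namespace POVM

variable {H : Type*} [NormedAddCommGroup H] [InnerProductSpace ℂ H] [CompleteSpace H]
  {Ω Ω' : Type*} [MeasurableSpace Ω] [MeasurableSpace Ω']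

instance (M : POVM Ω H) (ψ : H) : IsFiniteMeasure (M.vecMeasure ψ) :=
  ⟨by rw [M.vecMeasure_apply ψ MeasurableSet.univ]; exact ENNReal.ofReal_lt_top⟩

instance (M : POVM Ω H) (ρ : DensityOperator H) : IsProbabilityMeasure (M.dist ρ) :=
  ⟨by
    rw [M.dist_apply ρ MeasurableSet.univ, M.map_univ, mul_one, trace, ρ.hasSum_trace.tsum_eq]
    simp⟩

/-- Cyclicity of the trace with `ρ = r²` turns `Tr(ρ M(Z))` into a sum of quadratic forms; it lets
weak integrals against vector measures pass to traces. -/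
theorem dist_eq_sum (M : POVM Ω H) (ρ : DensityOperator H) {r : H →L[ℂ] H}
    (hr : IsSelfAdjoint r) (hrr : r * r = ρ.op) :
    M.dist ρ = Measure.sum fun j => M.vecMeasure (r (basis H j)) := by
  ext Z hZ
  rw [M.dist_apply ρ hZ, M.ofReal_trace ρ hr hrr hZ, Measure.sum_apply _ hZ]

/-- If `T` is the weak integral of `g` with respect to `M`, then `∫ g dM_ρ = Tr(ρ T)`. -/
theorem integral_dist (M : POVM Ω H) (ρ : DensityOperator H) {g : Ω → ℂ} {T : H →L[ℂ] H}
    (hg : Integrable g (M.dist ρ)) (hT : ∀ ψ, ∫ z, g z ∂(M.vecMeasure ψ) = inner ℂ ψ (T ψ)) :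
    ∫ z, g z ∂(M.dist ρ) = trace (ρ.op * T) := by
  obtain ⟨r, hr, hrr⟩ := exists_sqrt ρ
  rw [M.dist_eq_sum ρ hr hrr] at hg ⊢
  have h1 := hasSum_integral_measure hg
  simp_rw [hT] at h1
  exact h1.unique (hasSum_trace_mul ρ hr hrr T)

/-- On a complex Hilbert space the quadratic form determines the operator. The conjugation by `T` is
there for covariance; `T = 1` gives extensionality. -/
theorem toFun_eq_of_vecMeasure (M N : POVM Ω H) {Z Z' : Set Ω} (hZ : MeasurableSet Z)
    (hZ' : MeasurableSet Z') (T : H →L[ℂ] H)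
    (h : ∀ ψ, M.vecMeasure ψ Z = N.vecMeasure (T ψ) Z') :
    M.toFun Z = T.adjoint * N.toFun Z' * T := by
  have key : ∀ ψ : H, inner ℂ (M.toFun Z ψ) ψ = inner ℂ ((T.adjoint * N.toFun Z' * T) ψ) ψ := by
    intro ψ
    have h0 := h ψ
    have hp : ∀ (P : POVM Ω H) Z φ, 0 ≤ (inner ℂ φ (P.toFun Z φ) : ℂ).re := fun P Z φ =>
      (P.isPositive Z).re_inner_nonneg_right φ
    rw [M.vecMeasure_apply ψ hZ, N.vecMeasure_apply _ hZ',
      ENNReal.ofReal_eq_ofReal_iff (hp M _ _) (hp N _ _)] at h0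
    have e : ∀ (P : POVM Ω H) Z φ,
        inner ℂ (P.toFun Z φ) φ = ((inner ℂ φ (P.toFun Z φ) : ℂ).re : ℂ) := by
      intro P Z φ
      have := (ContinuousLinearMap.isPositive_iff_complex _).1 (P.isPositive Z) φ
      rw [← this.1]
      exact congrArg _ (inner_re_symm (𝕜 := ℂ) _ _)
    have e2 : inner ℂ ((T.adjoint * N.toFun Z' * T) ψ) ψ = inner ℂ (N.toFun Z' (T ψ)) (T ψ) := by
      change inner ℂ (T.adjoint (N.toFun Z' (T ψ))) ψ = _
      rw [ContinuousLinearMap.adjoint_inner_left]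
    rw [e2, e M, e N, h0]
  have := (ext_inner_map (M.toFun Z).toLinearMap (T.adjoint * N.toFun Z' * T).toLinearMap).1 key
  exact ContinuousLinearMap.coe_injective this

theorem ext_of_vecMeasure {M N : POVM Ω H} (h : ∀ ψ, M.vecMeasure ψ = N.vecMeasure ψ) :
    M = N := by
  refine POVM.ext (funext fun Z => ?_)
  by_cases hZ : MeasurableSet Z
  · have := toFun_eq_of_vecMeasure M N hZ hZ 1 fun ψ => by rw [h]; rfl
    rw [this, ← ContinuousLinearMap.star_eq_adjoint, star_one, one_mul, mul_one]
  · rw [M.not_measurable Z hZ, N.not_measurable Z hZ]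

theorem vecMeasure_map (M : POVM Ω H) {f : Ω → Ω'} (hf : Measurable f) (ψ : H) :
    (M.map f hf).vecMeasure ψ = (M.vecMeasure ψ).map f := by
  ext A hA
  rw [vecMeasure_apply _ _ hA, Measure.map_apply hf hA, vecMeasure_apply _ _ (hf hA)]
  simp [POVM.map, hA]

theorem vecMeasure_unitaryConj (M : POVM Ω H) (U : H ≃ₗᵢ[ℂ] H) (ψ : H) :
    (M.unitaryConj U).vecMeasure ψ = M.vecMeasure (U ψ) := by
  ext A hA
  rw [vecMeasure_apply _ _ hA, vecMeasure_apply _ _ hA]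
  congr 2
  change inner ℂ ψ (U.symm (M.toFun A (U ψ))) = _
  rw [← U.inner_map_map, U.apply_symm_apply]

/-- Every linear functional on the plane is `k x + l p`, so these integrals exhaust the
characteristic function of the measure. -/
theorem measure_ext_of_integral_exp {μ ν : Measure (ℝ × ℝ)} [IsFiniteMeasure μ]
    [IsFiniteMeasure ν] (h : ∀ k l : ℝ,
      ∫ z : ℝ × ℝ, Complex.exp (Complex.I * ((k * z.1 + l * z.2 : ℝ) : ℂ)) ∂μ =
      ∫ z : ℝ × ℝ, Complex.exp (Complex.I * ((k * z.1 + l * z.2 : ℝ) : ℂ)) ∂ν) : μ = ν := by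
  refine Measure.ext_of_charFunDual (funext fun L => ?_)
  have e : ∀ z : ℝ × ℝ, L z = L (1, 0) * z.1 + L (0, 1) * z.2 := by
    intro z
    have : z = z.1 • ((1 : ℝ), (0 : ℝ)) + z.2 • ((0 : ℝ), (1 : ℝ)) := by ext <;> simp
    conv_lhs => rw [this]
    rw [map_add, map_smul, map_smul, smul_eq_mul, smul_eq_mul, mul_comm z.1, mul_comm z.2]
  have := h (L (1, 0)) (L (0, 1))
  simp_rw [← e, mul_comm Complex.I] at this
  exact this

theorem ext_of_hasCharFunAt {M N : POVM (ℝ × ℝ) H} {T : ℝ → ℝ → H →L[ℂ] H}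
    (hM : ∀ k l, M.HasCharFunAt k l (T k l)) (hN : ∀ k l, N.HasCharFunAt k l (T k l)) : M = N :=
  ext_of_vecMeasure fun ψ => measure_ext_of_integral_exp fun k l => by rw [hM k l ψ, hN k l ψ]

theorem charFun_fst (M : POVM (ℝ × ℝ) H) (ρ : DensityOperator H) {T : ℝ → ℝ → H →L[ℂ] H}
    (hM : ∀ k l, M.HasCharFunAt k l (T k l)) (k : ℝ) :
    charFun (M.fst.dist ρ) k = trace (ρ.op * T k 0) := by
  rw [charFun_apply_real]
  refine M.fst.integral_dist ρ ?_ fun ψ => ?_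
  · refine Integrable.of_bound (by fun_prop) 1 (Filter.Eventually.of_forall fun x => ?_)
    rw [← Complex.ofReal_mul, Complex.norm_exp_ofReal_mul_I]
  · rw [← hM k 0 ψ, POVM.fst, vecMeasure_map,
      integral_map measurable_fst.aemeasurable (by fun_prop)]
    refine integral_congr_ae (Filter.Eventually.of_forall fun z => ?_)
    simp [mul_comm]

theorem charFun_snd (M : POVM (ℝ × ℝ) H) (ρ : DensityOperator H) {T : ℝ → ℝ → H →L[ℂ] H}
    (hM : ∀ k l, M.HasCharFunAt k l (T k l)) (l : ℝ) :
    charFun (M.snd.dist ρ) l = trace (ρ.op * T 0 l) := by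
  rw [charFun_apply_real]
  refine M.snd.integral_dist ρ ?_ fun ψ => ?_
  · refine Integrable.of_bound (by fun_prop) 1 (Filter.Eventually.of_forall fun x => ?_)
    rw [← Complex.ofReal_mul, Complex.norm_exp_ofReal_mul_I]
  · rw [← hM 0 l ψ, POVM.snd, vecMeasure_map,
      integral_map measurable_snd.aemeasurable (by fun_prop)]
    refine integral_congr_ae (Filter.Eventually.of_forall fun z => ?_)
    simp [mul_comm]

end POVM

/-! ### Multiplication observables and the position and momentum distributions. -/

variable {m n : ℕ}

/-- The measure with density `|ψ|²`. -/
def densityMeasure (ψ : WaveSpace n) : Measure (Space n) :=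
  (volume : Measure (Space n)).withDensity fun y => ((‖ψ y‖₊ ^ 2 : NNReal) : ℝ≥0∞)

theorem ofReal_inner_mulOp_ind {Z : Set (Space n)} (hZ : MeasurableSet Z) (ψ : WaveSpace n) :
    ENNReal.ofReal (inner ℂ ψ (mulOp (ind Z) ψ) : ℂ).re = densityMeasure ψ Z := by
  have e : inner ℂ ψ (mulOp (ind Z) ψ) = ((∫ y in Z, ‖ψ y‖ ^ 2 : ℝ) : ℂ) := by
    rw [inner_mulOp_ind hZ, ← integral_complex_ofReal]
    congr 1 with y
    simp [inner_self_eq_norm_sq_to_K]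
  rw [e, Complex.ofReal_re, densityMeasure, withDensity_apply _ hZ,
    ofReal_integral_eq_lintegral_ofReal ((Lp.memLp ψ).integrable_norm_pow (by norm_num)).integrableOn
      (Filter.Eventually.of_forall fun y => by positivity)]
  refine lintegral_congr fun y => ?_
  rw [← ENNReal.ofReal_coe_nnreal]
  simp

theorem integral_densityMeasure (ψ : WaveSpace n) {θ : Space n → ℝ} (hθ : Measurable θ) :
    ∫ y, Complex.exp (Complex.I * (θ y : ℂ)) ∂(densityMeasure ψ) = inner ℂ ψ (phaseOp θ ψ) := by
  have hm : Measurable fun y => (‖ψ y‖₊ ^ 2 : NNReal) :=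
    ((Lp.stronglyMeasurable ψ).measurable.nnnorm).pow_const 2
  rw [densityMeasure, integral_withDensity_eq_integral_smul hm, L2.inner_def]
  refine integral_congr_ae ?_
  filter_upwards [phaseOp_coeFn hθ ψ] with y hy
  rw [hy, RCLike.inner_apply, mul_assoc, RCLike.mul_conj, NNReal.smul_def]
  simp [mul_comm]

theorem vecMeasure_multiplicationPVM {f : Space n → ℝ} (hf : Measurable f) (ψ : WaveSpace n) :
    (multiplicationPVM f hf).vecMeasure ψ = (densityMeasure ψ).map f := by
  ext A hA
  rw [POVM.vecMeasure_apply _ _ hA, Measure.map_apply hf hA, ← ofReal_inner_mulOp_ind (hf hA)]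
  simp [multiplicationPVM, hA]

theorem integral_multiplicationPVM {f : Space n → ℝ} (hf : Measurable f) (ψ : WaveSpace n)
    (t : ℝ) : ∫ x : ℝ, Complex.exp ((t : ℂ) * (x : ℂ) * Complex.I)
      ∂((multiplicationPVM f hf).vecMeasure ψ) = inner ℂ ψ (phaseOp (fun y => t * f y) ψ) := by
  rw [vecMeasure_multiplicationPVM, integral_map hf.aemeasurable (by fun_prop),
    ← integral_densityMeasure ψ (by fun_prop)]
  refine integral_congr_ae (Filter.Eventually.of_forall fun y => ?_)
  simp [mul_comm]

theorem integrable_charFun_integrand (μ : Measure ℝ) [IsFiniteMeasure μ] (t : ℝ) :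
    Integrable (fun x : ℝ => Complex.exp ((t : ℂ) * (x : ℂ) * Complex.I)) μ := by
  refine Integrable.of_bound (by fun_prop) 1 (Filter.Eventually.of_forall fun x => ?_)
  rw [← Complex.ofReal_mul, Complex.norm_exp_ofReal_mul_I]

theorem charFun_position (u : Space n) (ℏ : ℝ) (hℏ : ℏ ≠ 0) (ρ : DensityOperator (WaveSpace n))
    (t : ℝ) : charFun ((positionPVM u).dist ρ) t = trace (ρ.op * weyl ℏ 0 ((ℏ * t) • u)) := by
  rw [charFun_apply_real]
  refine POVM.integral_dist _ ρ (integrable_charFun_integrand _ t) fun ψ => ?_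
  rw [positionPVM, integral_multiplicationPVM, weyl_eq, shiftOp_zero]
  congr 1
  refine phaseOp_congr (fun y => ?_) ψ
  rw [inner_zero_right, real_inner_smul_left]
  field_simp; simp

/-- In the Fourier picture `exp(i t P_v)` is a linear phase, which is the Fourier image of a
translation by `-ℏ t v`. -/
theorem charFun_momentum (v : Space n) (ℏ : ℝ) (ρ : DensityOperator (WaveSpace n))
    (t : ℝ) : charFun ((momentumPVM ℏ v).dist ρ) t = trace (ρ.op * weyl ℏ (-(ℏ * t) • v) 0) := by
  rw [charFun_apply_real]
  refine POVM.integral_dist _ ρ (integrable_charFun_integrand _ t) fun ψ => ?_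
  rw [momentumPVM, POVM.vecMeasure_unitaryConj, integral_multiplicationPVM, weyl_eq]
  have e : phaseOp (fun ξ => t * (2 * Real.pi * ℏ * inner ℝ v ξ)) (fourierL2 n ψ) =
      fourierL2 n (shiftOp (-(ℏ * t) • v) ψ) := by
    rw [fourierL2_shiftOp]
    refine phaseOp_congr (fun y => ?_) _
    rw [real_inner_smul_left]
    ring
  rw [e, LinearIsometryEquiv.inner_map_map]
  congr 1
  rw [← phaseOp_zero (shiftOp _ ψ), phaseOp_phaseOp (by fun_prop) (by fun_prop)]
  exact phaseOp_congr (fun y => by simp) _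

theorem isPositive_mulOp_ind {Z : Set (Space n)} (hZ : MeasurableSet Z) :
    (mulOp (ind Z)).IsPositive := by
  refine (ContinuousLinearMap.isPositive_iff_complex _).2 fun ψ => ?_
  have e : inner ℂ (mulOp (ind Z) ψ) ψ = ((∫ y in Z, ‖ψ y‖ ^ 2 : ℝ) : ℂ) := by
    rw [← inner_conj_symm, inner_mulOp_ind hZ, ← integral_conj, ← integral_complex_ofReal]
    congr 1 with y
    simp [inner_self_eq_norm_sq_to_K]
  rw [e]
  refine ⟨by simp, ?_⟩
  simpa using integral_nonneg fun y => by positivity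

open Classical in
/-- The observable `Z ↦ A* 1_Z A` on `L²(ℝⁿ)` for an isometry `A` into `L²(ℝᵐ)`. -/
def isometryPOVM (A : WaveSpace n →ₗᵢ[ℂ] WaveSpace m) : POVM (Space m) (WaveSpace n) where
  toFun Z := if MeasurableSet Z then
    A.toContinuousLinearMap.adjoint ∘L mulOp (ind Z) ∘L A.toContinuousLinearMap else 0
  isPositive Z := by
    split_ifs with hZ
    · exact (isPositive_mulOp_ind hZ).adjoint_conj _
    · exact ContinuousLinearMap.isPositive_zero
  map_univ := by
    rw [if_pos MeasurableSet.univ]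
    have h : mulOp (ind (Set.univ : Set (Space m))) = 1 := by
      ext1 ψ
      apply Lp.ext
      filter_upwards [mulOp_coeFn (memLp_ind (n := m) MeasurableSet.univ) ψ] with y hy
      rw [hy]
      simp [ind]
    ext1 ψ
    refine ext_inner_left ℂ fun φ => ?_
    rw [h, ContinuousLinearMap.comp_apply, ContinuousLinearMap.adjoint_inner_right]
    exact A.inner_map_map φ ψ
  not_measurable Z hZ := if_neg hZ
  hasSum_iUnion Z hZ hd φ ψ := by
    simp only [hZ, MeasurableSet.iUnion hZ, if_true, ContinuousLinearMap.comp_apply,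
      ContinuousLinearMap.adjoint_inner_right]
    rw [inner_mulOp_ind (MeasurableSet.iUnion hZ), funext fun i => inner_mulOp_ind (hZ i) _ _]
    exact hasSum_integral_iUnion hZ hd (L2.integrable_inner _ _).integrableOn

theorem vecMeasure_isometryPOVM (A : WaveSpace n →ₗᵢ[ℂ] WaveSpace m) (ψ : WaveSpace n) :
    (isometryPOVM A).vecMeasure ψ = densityMeasure (A ψ) := by
  ext Z hZ
  rw [POVM.vecMeasure_apply _ _ hZ, ← ofReal_inner_mulOp_ind hZ]
  simp only [isometryPOVM, hZ, if_true, ContinuousLinearMap.comp_apply,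
    ContinuousLinearMap.adjoint_inner_right]
  rfl

end

section

/-! ### Joint diagonalization of commuting positions and momenta -/

variable {m n : ℕ}

/-- An isometry of `L²(ℝᵐ)` that transforms `P_v` and the positions orthogonal to `v` into
multiplication operators. -/
def chirpIso (v : Space m) : WaveSpace m →ₗᵢ[ℂ] WaveSpace m :=
  (fourierL2 m).symm.toLinearIsometry.comp <|
    (phaseIso (fun y => Real.pi / ‖v‖ ^ 2 * inner ℝ v y ^ 2) (by fun_prop)).comp <|
    (fourierL2 m).toLinearIsometry.comp <|
    (phaseIso (fun y => Real.pi / ‖v‖ ^ 2 * inner ℝ v y ^ 2) (by fun_prop))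

theorem chirpIso_apply (v : Space m) (ψ : WaveSpace m) :
    chirpIso v ψ = (fourierL2 m).symm (phaseOp (fun y => Real.pi / ‖v‖ ^ 2 * inner ℝ v y ^ 2)
      (fourierL2 m (phaseOp (fun y => Real.pi / ‖v‖ ^ 2 * inner ℝ v y ^ 2) ψ))) := rfl

/-- A quadratic phase followed by a translation is the translated quadratic phase, which differs
from the original by a linear phase and a constant. Alternating two such phases with the Fourier
transform therefore acts as a quarter turn in the phase plane of `v`. Orthogonality keeps the
position along `u` untouched. -/
theorem phaseOp_chirpIso {u v : Space m} (hv : v ≠ 0) (huv : inner ℝ u v = 0) (k s : ℝ)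
    (ψ : WaveSpace m) :
    phaseOp (fun y => k * inner ℝ u y - 2 * Real.pi * s * inner ℝ v y) (chirpIso v ψ) =
      chirpIso v (phaseOp (fun y => k * inner ℝ u y) (shiftOp (-(s • v)) ψ)) := by
  have hN : ‖v‖ ^ 2 ≠ 0 := by simpa using hv
  have hpi : Real.pi ≠ 0 := Real.pi_ne_zero
  -- Chosen so that the phase on the left is `2π t·y`, that is, the one the inverse Fourier
  -- transform produces from the translation by `t`.
  set t : Space m := (k / (2 * Real.pi)) • u - s • v with ht
  have hvu : inner ℝ v u = 0 := by rw [real_inner_comm, huv]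
  have hvt : inner ℝ v t = -(s * ‖v‖ ^ 2) := by
    rw [ht, inner_sub_right, real_inner_smul_right, real_inner_smul_right, hvu,
      real_inner_self_eq_norm_sq]
    ring
  have hty : ∀ y, 2 * Real.pi * inner ℝ t y = k * inner ℝ u y - 2 * Real.pi * s * inner ℝ v y := by
    intro y
    rw [ht, inner_sub_left, real_inner_smul_left, real_inner_smul_left]
    field_simp
  have h1 : ∀ φ, phaseOp (fun y => k * inner ℝ u y - 2 * Real.pi * s * inner ℝ v y)
      ((fourierL2 m).symm φ) = (fourierL2 m).symm (shiftOp t φ) := by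
    intro φ
    rw [LinearIsometryEquiv.eq_symm_apply, ← phaseOp_congr hty, fourierL2_phaseOp,
      LinearIsometryEquiv.apply_symm_apply]
  have h2 : ∀ φ, shiftOp t (fourierL2 m φ) =
      fourierL2 m (phaseOp (fun y => 2 * Real.pi * inner ℝ t y) φ) := fun φ =>
    (fourierL2_phaseOp t φ).symm
  -- Expanding the square, the cross term is `2π s v·y`, the Fourier image of the translation by `-s
  -- v`; the constant left over cancels in the last step.
  have h3 : ∀ φ : WaveSpace m, phaseOp (fun y => Real.pi / ‖v‖ ^ 2 * inner ℝ v (y - t) ^ 2)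
      (fourierL2 m φ) = phaseOp (fun y => Real.pi / ‖v‖ ^ 2 * inner ℝ v y ^ 2) (fourierL2 m
        (phaseOp (fun _ => Real.pi * s ^ 2 * ‖v‖ ^ 2) (shiftOp (-(s • v)) φ))) := by
    intro φ
    rw [phaseOp_const, map_smul, fourierL2_shiftOp, ← phaseOp_const,
      phaseOp_phaseOp (by fun_prop) (by fun_prop), phaseOp_phaseOp (by fun_prop) (by fun_prop)]
    refine phaseOp_congr (fun y => ?_) _
    rw [inner_sub_right, hvt, inner_neg_left, real_inner_smul_left]
    field_simp
    ring
  rw [chirpIso_apply, chirpIso_apply, h1, shiftOp_phaseOp (by fun_prop), h2, h3]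
  congr 3
  rw [shiftOp_phaseOp (by fun_prop), shiftOp_phaseOp (by fun_prop),
    phaseOp_phaseOp (by fun_prop) (by fun_prop), phaseOp_phaseOp (by fun_prop) (by fun_prop),
    phaseOp_phaseOp (by fun_prop) (by fun_prop)]
  refine phaseOp_congr (fun y => ?_) _
  rw [hty, sub_neg_eq_add, inner_add_right, inner_add_right, real_inner_smul_right,
    real_inner_smul_right, huv, real_inner_self_eq_norm_sq]
  field_simp
  ring

/-- The bi-observable obtained by measuring jointly the commuting operators `Q_u` and `P_v`,
`u ⊥ v`, on `L²(ℝᵐ)` after the isometry `A`. -/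
def jointPOVM (ℏ : ℝ) (u v : Space m) (A : WaveSpace n →ₗᵢ[ℂ] WaveSpace m) :
    POVM (ℝ × ℝ) (WaveSpace n) :=
  (isometryPOVM ((chirpIso v).comp A)).map
    (fun y => (inner ℝ u y, -(2 * Real.pi * ℏ * inner ℝ v y))) (by fun_prop)

theorem integral_jointPOVM (ℏ : ℝ) {u v : Space m} (hv : v ≠ 0) (huv : inner ℝ u v = 0)
    (A : WaveSpace n →ₗᵢ[ℂ] WaveSpace m) (ψ : WaveSpace n) (k l : ℝ) :
    ∫ z : ℝ × ℝ, Complex.exp (Complex.I * ((k * z.1 + l * z.2 : ℝ) : ℂ))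
      ∂((jointPOVM ℏ u v A).vecMeasure ψ) =
      inner ℂ (A ψ) (phaseOp (fun y => k * inner ℝ u y) (shiftOp (-((ℏ * l) • v)) (A ψ))) := by
  rw [jointPOVM, POVM.vecMeasure_map, integral_map (by fun_prop) (by fun_prop),
    vecMeasure_isometryPOVM, integral_densityMeasure _ (by fun_prop),
    ← LinearIsometry.inner_map_map (chirpIso v) (A ψ), ← phaseOp_chirpIso hv huv]
  refine congrArg (inner ℂ (chirpIso v (A ψ))) ?_
  exact phaseOp_congr (fun y => by ring) _

/-! ### Tensoring with a vector of `L²(ℝ)` -/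

/-- The splitting `ℝⁿ⁺¹ = ℝ × ℝⁿ`. -/
def splitEquiv (n : ℕ) : Space (n + 1) ≃ᵐ ℝ × Space n :=
  (MeasurableEquiv.toLp 2 (Fin (n + 1) → ℝ)).symm.trans <|
    (MeasurableEquiv.piFinSuccAbove (fun _ => ℝ) 0).trans <|
    (MeasurableEquiv.refl ℝ).prodCongr (MeasurableEquiv.toLp 2 (Fin n → ℝ))

theorem splitEquiv_fst (Y : Space (n + 1)) : (splitEquiv n Y).1 = Y 0 := rfl

theorem splitEquiv_snd (Y : Space (n + 1)) (j : Fin n) : (splitEquiv n Y).2 j = Y j.succ := rfl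

theorem measurePreserving_splitEquiv : MeasurePreserving (splitEquiv n) volume volume :=
  (EuclideanSpace.volume_preserving_symm_measurableEquiv_toLp _).trans <|
    (volume_preserving_piFinSuccAbove (fun _ : Fin (n + 1) => ℝ) 0).trans <|
    (MeasurePreserving.id volume).prod (PiLp.volume_preserving_toLp (Fin n))

/-- The vector `(a, w)` of `ℝⁿ⁺¹`. -/
def consVec (a : ℝ) (w : Space n) : Space (n + 1) := WithLp.toLp 2 (Fin.cons a fun j => w j)

theorem inner_consVec (a : ℝ) (w : Space n) (Y : Space (n + 1)) :
    inner ℝ (consVec a w) Y = a * (splitEquiv n Y).1 + inner ℝ w (splitEquiv n Y).2 := by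
  rw [PiLp.inner_apply, Fin.sum_univ_succ, PiLp.inner_apply]
  simp [consVec, splitEquiv_fst, splitEquiv_snd, mul_comm]

theorem splitEquiv_consVec (a : ℝ) (w : Space n) : splitEquiv n (consVec a w) = (a, w) := by
  refine Prod.ext rfl ?_
  ext j
  rfl

theorem splitEquiv_sub (X Y : Space (n + 1)) :
    splitEquiv n (X - Y) = splitEquiv n X - splitEquiv n Y := by
  refine Prod.ext rfl ?_
  ext j
  rfl

theorem quasiMeasurePreserving_splitEquiv_snd :
    Measure.QuasiMeasurePreserving (fun Y => (splitEquiv n Y).2) volume volume :=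
  Measure.quasiMeasurePreserving_snd.comp
    measurePreserving_splitEquiv.quasiMeasurePreserving

theorem memLp_tensor {g : ℝ → ℂ} (hg : MemLp g 2 volume) (ψ : WaveSpace n) :
    MemLp (fun Y => g (splitEquiv n Y).1 * ψ (splitEquiv n Y).2) 2
      (volume : Measure (Space (n + 1))) := by
  refine MemLp.comp_measurePreserving (f := splitEquiv n) (g := fun z => g z.1 * ψ z.2) ?_
    measurePreserving_splitEquiv
  refine (memLp_two_iff_integrable_sq_norm (hg.1.comp_fst.mul (Lp.memLp ψ).1.comp_snd)).2 ?_
  refine Integrable.congr (f := fun z : ℝ × Space n => ‖g z.1‖ ^ 2 * ‖ψ z.2‖ ^ 2) ?_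
    (Filter.Eventually.of_forall fun z => by simp [mul_pow])
  exact ((memLp_two_iff_integrable_sq_norm hg.1).1 hg).mul_prod
    ((memLp_two_iff_integrable_sq_norm (Lp.memLp ψ).1).1 (Lp.memLp ψ))

/-- The vector `g ⊗ ψ` of `L²(ℝⁿ⁺¹)`. -/
def tensor {g : ℝ → ℂ} (hg : MemLp g 2 volume) (ψ : WaveSpace n) : WaveSpace (n + 1) :=
  (memLp_tensor hg ψ).toLp _

theorem tensor_coeFn {g : ℝ → ℂ} (hg : MemLp g 2 volume) (ψ : WaveSpace n) :
    tensor hg ψ =ᵐ[volume] fun Y => g (splitEquiv n Y).1 * ψ (splitEquiv n Y).2 :=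
  (memLp_tensor hg ψ).coeFn_toLp

theorem inner_tensor {g h : ℝ → ℂ} (hg : MemLp g 2 volume) (hh : MemLp h 2 volume)
    (φ ψ : WaveSpace n) : inner ℂ (tensor hg φ) (tensor hh ψ) =
      (∫ x, inner ℂ (g x) (h x)) * inner ℂ φ ψ := by
  rw [L2.inner_def, L2.inner_def, ← integral_prod_mul]
  refine Eq.trans ?_ (measurePreserving_splitEquiv.integral_comp (splitEquiv n).measurableEmbedding
    (fun z : ℝ × Space n => inner ℂ (g z.1) (h z.1) * inner ℂ (φ z.2) (ψ z.2)))
  refine integral_congr_ae ?_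
  filter_upwards [tensor_coeFn hg φ, tensor_coeFn hh ψ] with Y h1 h2
  rw [h1, h2]
  simp only [RCLike.inner_apply, map_mul]
  ring

/-- `ψ ↦ g ⊗ ψ` as an isometry, for a unit vector `g`. -/
def tensorIso {g : ℝ → ℂ} (hg : MemLp g 2 volume) (hg1 : ∫ x, inner ℂ (g x) (g x) = 1) :
    WaveSpace n →ₗᵢ[ℂ] WaveSpace (n + 1) where
  toFun := tensor hg
  map_add' φ ψ := by
    apply Lp.ext
    filter_upwards [tensor_coeFn hg φ, tensor_coeFn hg ψ, tensor_coeFn hg (φ + ψ),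
      Lp.coeFn_add (tensor hg φ) (tensor hg ψ),
      quasiMeasurePreserving_splitEquiv_snd.ae (Lp.coeFn_add φ ψ)] with Y h1 h2 h3 h4 h5
    rw [h3, h4, Pi.add_apply, h1, h2, h5, Pi.add_apply, mul_add]
  map_smul' c ψ := by
    apply Lp.ext
    filter_upwards [tensor_coeFn hg ψ, tensor_coeFn hg (c • ψ), Lp.coeFn_smul c (tensor hg ψ),
      quasiMeasurePreserving_splitEquiv_snd.ae (Lp.coeFn_smul c ψ)] with Y h1 h2 h3 h4
    rw [RingHom.id_apply, h3, h2, Pi.smul_apply, h1, h4, Pi.smul_apply, smul_eq_mul, smul_eq_mul]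
    ring
  norm_map' ψ := by
    have h := inner_tensor hg hg ψ ψ
    rw [hg1, one_mul, inner_self_eq_norm_sq_to_K, inner_self_eq_norm_sq_to_K] at h
    have h' : ‖tensor hg ψ‖ ^ 2 = ‖ψ‖ ^ 2 := by exact_mod_cast h
    exact (pow_left_inj₀ (norm_nonneg _) (norm_nonneg _) two_ne_zero).1 h'

theorem tensorIso_apply {g : ℝ → ℂ} (hg : MemLp g 2 volume) (hg1 : ∫ x, inner ℂ (g x) (g x) = 1)
    (ψ : WaveSpace n) : tensorIso hg hg1 ψ = tensor hg ψ := rfl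

/-- Linear phases and translations factor over `ℝ × ℝⁿ`; the displacement of the auxiliary
coordinate is absorbed into `h`. -/
theorem phaseOp_shiftOp_tensor {g h : ℝ → ℂ} (hg : MemLp g 2 volume) (hh : MemLp h 2 volume)
    (a b k : ℝ) (u v : Space n) (hgh : ∀ x, h x = Complex.exp (Complex.I * ((k * (a * x) : ℝ) : ℂ))
      * g (x - b)) (ψ : WaveSpace n) :
    phaseOp (fun Y => k * inner ℝ (consVec a u) Y) (shiftOp (consVec b v) (tensor hg ψ)) =
      tensor hh (phaseOp (fun y => k * inner ℝ u y) (shiftOp v ψ)) := by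
  apply Lp.ext
  filter_upwards [phaseOp_coeFn (f := fun Y => k * inner ℝ (consVec a u) Y) (by fun_prop)
      (shiftOp (consVec b v) (tensor hg ψ)),
    shiftOp_coeFn (consVec b v) (tensor hg ψ),
    (measurePreserving_sub_right volume (consVec b v)).quasiMeasurePreserving.ae
      (tensor_coeFn hg ψ),
    tensor_coeFn hh (phaseOp (fun y => k * inner ℝ u y) (shiftOp v ψ)),
    quasiMeasurePreserving_splitEquiv_snd.ae (phaseOp_coeFn (f := fun y => k * inner ℝ u y)
      (by fun_prop) (shiftOp v ψ)),
    quasiMeasurePreserving_splitEquiv_snd.ae (shiftOp_coeFn v ψ)] with Y h1 h2 h3 h4 h5 h6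
  rw [h1, h2, h3, h4, h5, h6, hgh, inner_consVec, splitEquiv_sub, splitEquiv_consVec, mul_add]
  push_cast
  rw [mul_add, Complex.exp_add]
  simp only [Prod.fst_sub, Prod.snd_sub]
  ring

/-- The wave function of the vacuum state in one dimension. -/
def vacuum (x : ℝ) : ℂ := (√(gaussianPDFReal 0 1 x) : ℝ)

/-- Completing the square: `x²/4 + (x - b)²/4 = (x - b/2)²/2 + b²/8`. -/
theorem vacuum_mul (b x : ℝ) : vacuum x * vacuum (x - b) =
    ((Real.exp (-(b ^ 2) / 8) * gaussianPDFReal (b / 2) 1 x : ℝ) : ℂ) := by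
  rw [vacuum, vacuum, ← Complex.ofReal_mul, ← Real.sqrt_mul (gaussianPDFReal_nonneg _ _ _)]
  congr 1
  rw [Real.sqrt_eq_iff_mul_self_eq (mul_nonneg (gaussianPDFReal_nonneg _ _ _)
    (gaussianPDFReal_nonneg _ _ _)) (mul_nonneg (Real.exp_nonneg _) (gaussianPDFReal_nonneg _ _ _))]
  simp only [gaussianPDFReal]
  rw [show ∀ r c e1 e2 : ℝ, r * (c * e1) * (r * (c * e2)) = c * c * ((r * e1) * (r * e2)) by
    intros; ring, show ∀ c e1 e2 : ℝ, c * e1 * (c * e2) = c * c * (e1 * e2) by intros; ring]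
  simp only [← Real.exp_add]
  congr 2
  push_cast
  ring

theorem memLp_vacuum : MemLp vacuum 2 volume := by
  have hm : AEStronglyMeasurable vacuum volume :=
    (Complex.measurable_ofReal.comp
      (measurable_gaussianPDFReal 0 1).sqrt).aestronglyMeasurable
  refine (memLp_two_iff_integrable_sq_norm hm).2 ?_
  refine (integrable_gaussianPDFReal 0 1).congr (Filter.Eventually.of_forall fun x => ?_)
  simp [vacuum, Real.sq_sqrt (gaussianPDFReal_nonneg 0 1 x)]

/-- By `vacuum_mul` this is, up to the factor `exp(-b²/8)`, the characteristic function of a unit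
Gaussian centred at `b/2`. It supplies both the noise and the ordering phase of the dilated
measurement. -/
theorem integral_vacuum (t b : ℝ) :
    ∫ x, inner ℂ (vacuum x) (Complex.exp (Complex.I * ((t * x : ℝ) : ℂ)) * vacuum (x - b)) =
      Complex.exp (Complex.I * ((t * b / 2 : ℝ) : ℂ) - ((t ^ 2 / 2 + b ^ 2 / 8 : ℝ) : ℂ)) := by
  have h := charFun_gaussianReal (μ := b / 2) (v := 1) t
  rw [charFun_apply_real, integral_gaussianReal_eq_integral_smul one_ne_zero] at h
  have e : ∀ x : ℝ, inner ℂ (vacuum x)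
      (Complex.exp (Complex.I * ((t * x : ℝ) : ℂ)) * vacuum (x - b)) =
      Complex.exp (((-(b ^ 2) / 8 : ℝ) : ℂ)) *
        (gaussianPDFReal (b / 2) 1 x • Complex.exp ((t : ℂ) * (x : ℂ) * Complex.I)) := by
    intro x
    have hc : (starRingEnd ℂ) (vacuum x) = vacuum x := Complex.conj_ofReal _
    have hv := vacuum_mul b x
    push_cast at hv
    rw [RCLike.inner_apply, hc, mul_assoc, mul_comm (vacuum _) (vacuum _), hv, Complex.real_smul]
    push_cast
    rw [show Complex.I * ((t : ℂ) * x) = t * x * Complex.I by ring]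
    ring
  rw [integral_congr_ae (Filter.Eventually.of_forall e), integral_const_mul, h, ← Complex.exp_add]
  congr 1
  push_cast
  ring

theorem integral_vacuum_self : ∫ x, inner ℂ (vacuum x) (vacuum x) = 1 := by
  simpa using integral_vacuum 0 0

/-- A Gaussian smearing of the joint measurement of `Q_u` and `P_v`, with noise variances `a²` and
`ℏ² b² / 4`. -/
def smearedPOVM (ℏ : ℝ) (u v : Space n) (a b : ℝ) : POVM (ℝ × ℝ) (WaveSpace n) :=
  jointPOVM ℏ (consVec a u) (consVec b v) (tensorIso memLp_vacuum integral_vacuum_self)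

/-- The condition `hab` says that the extended vectors are orthogonal, so the dilated position and
momentum commute. Taking the vacuum expectation leaves a Weyl operator times a Gaussian factor. -/
theorem hasCharFunAt_smearedPOVM {ℏ : ℝ} (hℏ : ℏ ≠ 0) {u v : Space n} (hv : v ≠ 0) {a b : ℝ}
    (hab : a * b = -inner ℝ u v) (k l : ℝ) :
    (smearedPOVM ℏ u v a b).HasCharFunAt k l
      (Complex.exp (-((k ^ 2 * a ^ 2 / 2 + l ^ 2 * (ℏ ^ 2 * b ^ 2 / 4) / 2 : ℝ) : ℂ)) •
        weyl ℏ (-((ℏ * l) • v)) ((ℏ * k) • u)) := by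
  intro ψ
  have hv' : consVec b v ≠ 0 := by
    intro h
    have := congrArg (splitEquiv n) h
    rw [splitEquiv_consVec] at this
    refine hv ?_
    have h2 := congrArg Prod.snd this
    simp only at h2
    rw [h2]
    ext j
    rfl
  have huv' : inner ℝ (consVec a u) (consVec b v) = 0 := by
    rw [inner_consVec, splitEquiv_consVec, hab]; ring
  have hs : -((ℏ * l) • consVec b v) = consVec (-(ℏ * l * b)) (-((ℏ * l) • v)) := by
    ext j
    refine Fin.cases ?_ (fun i => ?_) j <;> simp [consVec]
  have hh : MemLp (fun x => Complex.exp (Complex.I * ((k * (a * x) : ℝ) : ℂ)) *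
      vacuum (x - -(ℏ * l * b))) 2 volume := by
    have h1 := memLp_vacuum.comp_measurePreserving
      (measurePreserving_sub_right volume (-(ℏ * l * b)))
    refine h1.of_le (AEStronglyMeasurable.mul (by fun_prop) h1.1) ?_
    refine Filter.Eventually.of_forall fun x => ?_
    rw [norm_mul, norm_exp_I_mul_ofReal, one_mul]
    rfl
  rw [smearedPOVM, integral_jointPOVM ℏ hv' huv', tensorIso_apply, hs,
    phaseOp_shiftOp_tensor memLp_vacuum hh a (-(ℏ * l * b)) k u _ (fun _ => rfl), inner_tensor]
  have h2 := integral_vacuum (k * a) (-(ℏ * l * b))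
  simp only [mul_assoc k a] at h2
  rw [h2, smul_apply, inner_smul_right, weyl_eq]
  -- The Weyl operator differs from the product of phase and translation by an ordering phase; by
  -- `hab` the phase in `integral_vacuum` compensates it exactly.
  have h3 : phaseOp (fun y => (inner ℝ ((ℏ * k) • u) y -
      inner ℝ ((ℏ * k) • u) (-((ℏ * l) • v)) / 2) / ℏ) (shiftOp (-((ℏ * l) • v)) ψ) =
      Complex.exp (Complex.I * ((ℏ * k * l * inner ℝ u v / 2 : ℝ) : ℂ)) •
        phaseOp (fun y => k * inner ℝ u y) (shiftOp (-((ℏ * l) • v)) ψ) := by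
    rw [exp_smul_phaseOp (by fun_prop)]
    refine phaseOp_congr (fun y => ?_) _
    rw [inner_neg_right, real_inner_smul_left, real_inner_smul_left, real_inner_smul_right]
    field_simp
    ring
  rw [h3, inner_smul_right, ← mul_assoc (Complex.exp _) (Complex.exp _), ← Complex.exp_add]
  congr 2
  have hc : inner ℝ u v = -(a * b) := by rw [hab]; ring
  rw [hc]
  push_cast
  ring

end

section

/-! ### Relative entropy of Gaussian distributions -/

theorem llr_gaussianReal (m₁ m₂ : ℝ) {v₁ v₂ : NNReal} (h₁ : v₁ ≠ 0) (h₂ : v₂ ≠ 0) :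
    llr (gaussianReal m₁ v₁) (gaussianReal m₂ v₂) =ᵐ[gaussianReal m₁ v₁] fun x =>
      Real.log (v₂ / v₁) / 2 - (x - m₁) ^ 2 / (2 * v₁) + (x - m₂) ^ 2 / (2 * v₂) := by
  have hac := gaussianReal_absolutelyContinuous m₁ h₁
  have h0 : (gaussianReal m₁ v₁).rnDeriv (gaussianReal m₂ v₂) =ᵐ[volume]
      fun x => (gaussianPDF m₂ v₂ x)⁻¹ * gaussianPDF m₁ v₁ x := by
    have := Measure.rnDeriv_withDensity_right (gaussianReal m₁ v₁) volume
      (f := gaussianPDF m₂ v₂) (measurable_gaussianPDF _ _).aemeasurable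
      (Filter.Eventually.of_forall fun x => (gaussianPDF_pos m₂ h₂ x).ne')
      (Filter.Eventually.of_forall fun x => gaussianPDF_ne_top)
    rw [← gaussianReal_of_var_ne_zero m₂ h₂] at this
    filter_upwards [this, rnDeriv_gaussianReal m₁ v₁] with x hx hx2
    rw [hx, hx2]
  refine hac.ae_le ?_
  filter_upwards [h0] with x hx
  have p₁ : (0 : ℝ) < v₁ := by positivity
  have p₂ : (0 : ℝ) < v₂ := by positivity
  have hlog : ∀ v : ℝ, 0 < v →
      Real.log (√(2 * Real.pi * v)) = (Real.log (2 * Real.pi) + Real.log v) / 2 := fun v hv => by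
    rw [Real.log_sqrt (by positivity), Real.log_mul (by positivity) hv.ne']
  rw [llr, hx, ENNReal.toReal_mul, ENNReal.toReal_inv, toReal_gaussianPDF, toReal_gaussianPDF,
    Real.log_mul (inv_ne_zero (gaussianPDFReal_pos _ _ _ h₂).ne') (gaussianPDFReal_pos _ _ _ h₁).ne',
    Real.log_inv, gaussianPDFReal, gaussianPDFReal, Real.log_mul (by positivity) (by positivity),
    Real.log_mul (by positivity) (by positivity), Real.log_exp, Real.log_exp, Real.log_inv,
    Real.log_inv, hlog _ p₁, hlog _ p₂,
    Real.log_div (by positivity) (by positivity)]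
  ring

theorem integral_sq_sub_gaussianReal (m c : ℝ) (v : NNReal) :
    Integrable (fun x => (x - c) ^ 2) (gaussianReal m v) ∧
      ∫ x, (x - c) ^ 2 ∂(gaussianReal m v) = v + (m - c) ^ 2 := by
  have i2 : MemLp id 2 (gaussianReal m v) := memLp_id_gaussianReal' 2 (by simp)
  have i2' : MemLp (fun x : ℝ => x - m) 2 (gaussianReal m v) := i2.sub (memLp_const m)
  have j2 : Integrable (fun x : ℝ => (x - m) ^ 2) (gaussianReal m v) := i2'.integrable_sq
  have i1 : Integrable (fun x : ℝ => x - m) (gaussianReal m v) := i2'.integrable (by norm_num)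
  have hv : ∫ x, (x - m) ^ 2 ∂(gaussianReal m v) = v := by
    have := variance_eq_integral (μ := gaussianReal m v) (X := id) aemeasurable_id
    rw [variance_id_gaussianReal] at this
    simp only [id] at this
    rw [integral_id_gaussianReal] at this
    exact this.symm
  have h1 : ∫ x, (x - m) ∂(gaussianReal m v) = 0 := by
    have i : Integrable (fun x : ℝ => x) (gaussianReal m v) := i2.integrable (by norm_num)
    rw [integral_sub i (integrable_const m), integral_id_gaussianReal]
    simp
  have e : ∀ x : ℝ, (x - c) ^ 2 = (x - m) ^ 2 + (2 * (m - c)) * (x - m) + (m - c) ^ 2 := by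
    intro x; ring
  rw [funext e]
  refine ⟨(j2.add (i1.const_mul _)).add (integrable_const _), ?_⟩
  have j3 : Integrable (fun x => (x - m) ^ 2 + 2 * (m - c) * (x - m)) (gaussianReal m v) :=
    j2.add (i1.const_mul _)
  rw [integral_add j3 (integrable_const _), integral_add j2 (i1.const_mul _), integral_const_mul, hv, h1]
  simp

/-- The log-likelihood ratio is quadratic, so only second moments about `m₁` and `m₂` under the
first law are needed. -/
theorem klDiv_gaussianReal (m₁ m₂ : ℝ) {v₁ v₂ : NNReal} (h₁ : v₁ ≠ 0) (h₂ : v₂ ≠ 0) :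
    InformationTheory.klDiv (gaussianReal m₁ v₁) (gaussianReal m₂ v₂) =
      ENNReal.ofReal (Real.log (v₂ / v₁) / 2 - 1 / 2 + (v₁ + (m₁ - m₂) ^ 2) / (2 * v₂)) := by
  have hl := llr_gaussianReal m₁ m₂ h₁ h₂
  obtain ⟨i₁, e₁⟩ := integral_sq_sub_gaussianReal m₁ m₁ v₁
  obtain ⟨i₂, e₂⟩ := integral_sq_sub_gaussianReal m₁ m₂ v₁
  have p₁ : (0 : ℝ) < v₁ := by positivity
  have i₃ : Integrable (fun x => Real.log (v₂ / v₁) / 2 - (x - m₁) ^ 2 / (2 * (v₁ : ℝ)))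
      (gaussianReal m₁ v₁) := (integrable_const _).sub (i₁.div_const _)
  rw [InformationTheory.klDiv_of_ac_of_integrable
    ((gaussianReal_absolutelyContinuous m₁ h₁).trans (gaussianReal_absolutelyContinuous' m₂ h₂))
    ((i₃.add (i₂.div_const (2 * v₂))).congr hl.symm), integral_congr_ae hl]
  rw [integral_add i₃ (i₂.div_const _), integral_sub (integrable_const _) (i₁.div_const _),
    integral_const, integral_div, integral_div, e₁, e₂]
  congr 1
  simp
  field_simp

/-- The relative entropy of Gaussian distributions, when the second one is broader. -/
theorem relEntropy_gaussianReal (m δ : ℝ) {v w : NNReal} (hv : v ≠ 0) :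
    relEntropy (gaussianReal m v) (gaussianReal (m + δ) (v + w)) =
      ENNReal.ofReal (logE / 2 * (sFun (w / v) + δ ^ 2 / (v + w))) := by
  have p : (0 : ℝ) < v := by positivity
  have hE : 0 ≤ logE := Real.logb_nonneg (by norm_num) (by simp)
  rw [relEntropy, klDiv_gaussianReal _ _ hv (by simp [hv]), ← ENNReal.ofReal_mul hE]
  congr 1
  have e : (1 : ℝ) + w / v = (v + w) / v := by field_simp
  rw [sFun, e]
  push_cast
  have : (0 : ℝ) < v + w := by positivity
  field_simp
  ring

theorem logE_pos : 0 < logE := Real.logb_pos (by norm_num) (by simp)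

/-! ### The minimization problem -/

theorem sFun_nonneg {x : ℝ} (hx : 0 ≤ x) : 0 ≤ sFun x := by
  have h := Real.one_sub_inv_le_log_of_pos (show 0 < 1 + x by linarith)
  have : x / (1 + x) = 1 - (1 + x)⁻¹ := by field_simp; ring
  rw [sFun, this]
  linarith

theorem one_sub_inv_lt_log {t : ℝ} (ht : 0 < t) (h1 : t ≠ 1) : 1 - t⁻¹ < Real.log t := by
  have h := Real.log_lt_sub_one_of_pos (inv_pos.2 ht) (by simpa using h1)
  rw [Real.log_inv] at h
  linarith

/-- The strict inequality `1 - 1/t < ln t` at `t = (1 + w)/(1 + z)` outweighs the increase of `x/(1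
+ x)`. -/
theorem sFun_strictMono {z w : ℝ} (hz : 0 ≤ z) (hzw : z < w) : sFun z < sFun w := by
  have hz1 : 0 < 1 + z := by linarith
  have hw1 : 0 < 1 + w := by linarith
  have h := one_sub_inv_lt_log (t := (1 + w) / (1 + z)) (by positivity)
    (by rw [Ne, div_eq_one_iff_eq hz1.ne']; linarith)
  rw [Real.log_div hw1.ne' hz1.ne', inv_div] at h
  have e : w / (1 + w) - z / (1 + z) ≤ 1 - (1 + z) / (1 + w) := by
    rw [div_sub_div _ _ hw1.ne' hz1.ne', one_sub_div hw1.ne', div_le_div_iff₀ (by positivity) hw1]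
    nlinarith [mul_nonneg (mul_nonneg hw1.le hz) (sub_pos.2 hzw).le]
  rw [sFun, sFun]
  linarith

/-- By the arithmetic-geometric mean inequality, `(1 + x)(1 + y)` exceeds `(1 + w)²` unless `x = y`.
The logarithm of their quotient, bounded below by `1 - 1/t`, beats the change in the rational terms.
-/
theorem two_mul_sFun_le_add {x y w : ℝ} (hx : 0 ≤ x) (hy : 0 ≤ y) (hw : 0 ≤ w)
    (hxy : x * y = w ^ 2) :
    2 * sFun w ≤ sFun x + sFun y ∧ (sFun x + sFun y = 2 * sFun w → x = w ∧ y = w) := by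
  have hx1 : 0 < 1 + x := by linarith
  have hy1 : 0 < 1 + y := by linarith
  have hw1 : 0 < 1 + w := by linarith
  have hs : 2 * w ≤ x + y := by
    refine abs_le_of_sq_le_sq' ?_ (by positivity) |>.2
    nlinarith [sq_nonneg (x - y)]
  have key : x ≠ y → 2 * sFun w < sFun x + sFun y := by
    intro hne
    have hs' : 2 * w < x + y := by
      refine lt_of_le_of_ne hs fun h => hne ?_
      have : (x - y) ^ 2 = 0 := by nlinarith
      nlinarith [pow_eq_zero_iff (two_ne_zero) |>.1 this]
    have h := one_sub_inv_lt_log (t := (1 + x) * (1 + y) / ((1 + w) * (1 + w))) (by positivity)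
      (by rw [Ne, div_eq_one_iff_eq (by positivity)]; nlinarith)
    rw [Real.log_div (by positivity) (by positivity), Real.log_mul (by positivity) (by positivity),
      Real.log_mul (by positivity) (by positivity), inv_div] at h
    have e : x / (1 + x) + y / (1 + y) - 2 * (w / (1 + w)) ≤
        1 - (1 + w) * (1 + w) / ((1 + x) * (1 + y)) := by
      -- At fixed product `x y = w²`, the rational part depends only on `(1 + x)(1 + y)`, hence only
      -- on `x + y`.
      have h1 : x / (1 + x) + y / (1 + y) = 1 + (w ^ 2 - 1) / ((1 + x) * (1 + y)) := by
        rw [← hxy]; field_simp; ring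
      have h2 : 2 * (w / (1 + w)) = 1 + (w ^ 2 - 1) / ((1 + w) * (1 + w)) := by
        field_simp; ring
      have h3 : (1 + x) * (1 + y) = 1 + (x + y) + w ^ 2 := by rw [← hxy]; ring
      rw [h1, h2, h3]
      have hD : 0 < 1 + (x + y) + w ^ 2 := by positivity
      have : 1 - (1 + w) * (1 + w) / (1 + (x + y) + w ^ 2) -
          (1 + (w ^ 2 - 1) / (1 + (x + y) + w ^ 2) - (1 + (w ^ 2 - 1) / ((1 + w) * (1 + w)))) =
          2 * w * (x + y - 2 * w) / ((1 + w) * (1 + (x + y) + w ^ 2)) := by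
        field_simp; ring
      have : 0 ≤ 2 * w * (x + y - 2 * w) / ((1 + w) * (1 + (x + y) + w ^ 2)) := by
        have := sub_nonneg.2 hs
        positivity
      linarith
    rw [sFun, sFun, sFun]
    linarith
  by_cases h : x = y
  · subst h
    have : x = w := by
      have : x ^ 2 = w ^ 2 := by rw [← hxy]; ring
      exact (pow_left_inj₀ hx hw two_ne_zero).1 this
    subst this
    exact ⟨by linarith, fun _ => ⟨rfl, rfl⟩⟩
  · exact ⟨(key h).le, fun h' => absurd h' (key h).ne'⟩

/-- Passes through the geometric mean `√(x y) ≥ z`: first equalize `x` and `y` at fixed product,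
then use monotonicity. Equality forces both steps to be tight. -/
theorem two_mul_sFun_le {x y z : ℝ} (hx : 0 ≤ x) (hy : 0 ≤ y) (hz : 0 ≤ z)
    (hxy : z ^ 2 ≤ x * y) :
    2 * sFun z ≤ sFun x + sFun y ∧ (sFun x + sFun y = 2 * sFun z → x = z ∧ y = z) := by
  have hzw : z ≤ √(x * y) := Real.le_sqrt_of_sq_le hxy
  obtain ⟨h1, h2⟩ := two_mul_sFun_le_add hx hy (Real.sqrt_nonneg (x * y))
    (Real.sq_sqrt (mul_nonneg hx hy)).symm
  rcases hzw.eq_or_lt with h | h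
  · rw [← h] at h1 h2
    exact ⟨h1, h2⟩
  · have := sFun_strictMono hz h
    exact ⟨by linarith, fun h' => by linarith⟩

end

section

variable {n : ℕ}

/-! ### Phase-space vectors and uncertainty inequalities -/

theorem Omega_mulVec_inl (ℏ : ℝ) (w : Fin n ⊕ Fin n → ℝ) (j : Fin n) :
    (Omega n ℏ).mulVec w (Sum.inl j) = ℏ * w (Sum.inr j) := by
  simp [Omega, Matrix.fromBlocks_mulVec, Matrix.smul_mulVec]

theorem Omega_mulVec_inr (ℏ : ℝ) (w : Fin n ⊕ Fin n → ℝ) (j : Fin n) :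
    (Omega n ℏ).mulVec w (Sum.inr j) = -(ℏ * w (Sum.inl j)) := by
  simp [Omega, Matrix.fromBlocks_mulVec, Matrix.smul_mulVec, Matrix.neg_mulVec]

theorem weylVec_neg_Omega (ℏ : ℝ) (w : Fin n ⊕ Fin n → ℝ) :
    weylVec ℏ (-(Omega n ℏ).mulVec w) =
      weyl ℏ (-(ℏ • WithLp.toLp 2 fun j => w (Sum.inr j))) (ℏ • WithLp.toLp 2 fun j => w (Sum.inl j)) := by
  rw [weylVec]
  congr 1
  · ext j; simp [Omega_mulVec_inl]
  · ext j; simp [Omega_mulVec_inr]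

theorem weylVec_covMatrix (ℏ : ℝ) (u v : Space n) (k l : ℝ) :
    weylVec ℏ (-(Omega n ℏ).mulVec ((covMatrix u v).transpose.mulVec ![k, l])) =
      weyl ℏ (-((ℏ * l) • v)) ((ℏ * k) • u) := by
  rw [weylVec_neg_Omega]
  congr 1
  · ext j; simp [covMatrix, Matrix.mulVec, dotProduct, Fin.sum_univ_two]; ring
  · ext j; simp [covMatrix, Matrix.mulVec, dotProduct, Fin.sum_univ_two]; ring

theorem dotProduct_Omega_mulVec (ℏ : ℝ) (w w' : Fin n ⊕ Fin n → ℝ) :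
    w ⬝ᵥ (Omega n ℏ).mulVec w' = ℏ * ∑ j, (w (Sum.inl j) * w' (Sum.inr j)) -
      ℏ * ∑ j, (w (Sum.inr j) * w' (Sum.inl j)) := by
  rw [dotProduct, Fintype.sum_sum_type, Finset.mul_sum, Finset.mul_sum, sub_eq_add_neg,
    ← Finset.sum_neg_distrib]
  simp only [Omega_mulVec_inl, Omega_mulVec_inr]
  congr 1 <;> refine Finset.sum_congr rfl fun j _ => ?_ <;> ring

theorem covMatrix_mul_Omega (ℏ : ℝ) (u v : Space n) :
    covMatrix u v * Omega n ℏ * (covMatrix u v).transpose =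
      !![0, ℏ * inner ℝ u v; -(ℏ * inner ℝ u v), 0] := by
  have e : ∀ i j, (covMatrix u v * Omega n ℏ * (covMatrix u v).transpose) i j =
      covMatrix u v i ⬝ᵥ (Omega n ℏ).mulVec (covMatrix u v j) := fun i j => by
    rw [Matrix.mul_assoc]
    rfl
  ext i j
  rw [e, dotProduct_Omega_mulVec]
  fin_cases i <;> fin_cases j <;> simp [covMatrix, PiLp.inner_apply, mul_comm]

/-- Positivity is tested on the vector `a + i b`. The imaginary unit before `O` pairs its real and
imaginary parts, which is the source of every uncertainty inequality used. -/
theorem PosSemidef.dotProduct_le {ι : Type*} [Fintype ι] {V O : Matrix ι ι ℝ}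
    (h : (toComplex V + (Complex.I / 2) • toComplex O).PosSemidef) (a b : ι → ℝ) :
    (a ⬝ᵥ O.mulVec b - b ⬝ᵥ O.mulVec a) / 2 ≤ a ⬝ᵥ V.mulVec a + b ⬝ᵥ V.mulVec b := by
  have h1 := h.re_dotProduct_nonneg (fun i => (a i : ℂ) + b i * Complex.I)
  have e : ∀ i j, RCLike.re (star ((a i : ℂ) + b i * Complex.I) *
      ((toComplex V + (Complex.I / 2) • toComplex O) i j * ((a j : ℂ) + b j * Complex.I))) =
      a i * (V i j * a j) + b i * (V i j * b j) - (a i * (O i j * b j) - b i * (O i j * a j)) / 2 := by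
    intro i j
    simp [toComplex]
    ring
  simp only [dotProduct, Matrix.mulVec, Finset.mul_sum, map_sum, Pi.star_apply, e,
    Finset.sum_sub_distrib, Finset.sum_add_distrib, ← Finset.sum_div] at h1 ⊢
  linarith

theorem sq_le_of_forall_mul_le {A B d : ℝ}
    (h : ∀ s t : ℝ, s * t * d ≤ s ^ 2 * A + t ^ 2 * B) : d ^ 2 ≤ 4 * A * B := by
  have := discrim_le_zero (a := A) (b := -d) (c := B) fun x => by have := h x 1; nlinarith
  rw [discrim] at this
  linarith

/-! ### Gaussian distributions -/

theorem eq_gaussianReal_of_charFun {ν : Measure ℝ} [IsProbabilityMeasure ν] {m : ℝ} {a : NNReal}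
    (h : ∀ t : ℝ, charFun ν t = Complex.exp (Complex.I * ((t * m : ℝ) : ℂ) -
      ((t ^ 2 * a / 2 : ℝ) : ℂ))) : ν = gaussianReal m a := by
  refine Measure.ext_of_charFun (funext fun t => ?_)
  rw [h, charFun_gaussianReal]
  congr 1
  push_cast
  ring

theorem trace_mul_smul {H : Type*} [NormedAddCommGroup H] [InnerProductSpace ℂ H] [CompleteSpace H]
    (R T : H →L[ℂ] H) (c : ℂ) : trace (R * c • T) = c * trace (R * T) := by
  rw [trace, trace, ← tsum_mul_left]
  refine tsum_congr fun i => ?_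
  rw [mul_smul_comm, smul_apply, inner_smul_right]

/-- The position and momentum distributions of a Gaussian state are Gaussian, and their variances
obey the uncertainty relation. -/
theorem IsGaussianState.exists_gaussianReal {ℏ : ℝ} (hℏ : 0 < ℏ) {u v : Space n} (hu : ‖u‖ = 1)
    (hv : ‖v‖ = 1) {ρ : DensityOperator (WaveSpace n)} (hρ : IsGaussianState ℏ ρ) :
    ∃ (m₁ m₂ : ℝ) (A B : NNReal), A ≠ 0 ∧ B ≠ 0 ∧ (positionPVM u).dist ρ = gaussianReal m₁ A ∧
      (momentumPVM ℏ v).dist ρ = gaussianReal m₂ B ∧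
      (ℏ * inner ℝ u v) ^ 2 ≤ 4 * (A : ℝ) * B := by
  obtain ⟨μ, V, hV, hc⟩ := hρ
  -- The block vectors `(x, 0)` and `(0, x)`: under `-Ω` they give the Weyl operators generated by
  -- position and momentum along `x`.
  let wl : Space n → Fin n ⊕ Fin n → ℝ := fun u => Sum.elim (fun j => u j) 0
  let wr : Space n → Fin n ⊕ Fin n → ℝ := fun u => Sum.elim 0 (fun j => u j)
  have hO : ∀ x y : Space n, wl x ⬝ᵥ (Omega n ℏ).mulVec (wr y) = ℏ * inner ℝ x y := by
    intro x y
    simp [dotProduct_Omega_mulVec, wl, wr, PiLp.inner_apply, mul_comm]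
  have hO' : ∀ x y : Space n, wr y ⬝ᵥ (Omega n ℏ).mulVec (wl x) = -(ℏ * inner ℝ x y) := by
    intro x y
    simp [dotProduct_Omega_mulVec, wl, wr, PiLp.inner_apply, mul_comm]
  have hnn : ∀ w : Fin n ⊕ Fin n → ℝ, 0 ≤ w ⬝ᵥ V.mulVec w := fun w => by
    simpa using PosSemidef.dotProduct_le hV w 0
  have hunc : ∀ x y : Space n, (ℏ * inner ℝ x y) ^ 2 ≤
      4 * (wl x ⬝ᵥ V.mulVec (wl x)) * (wr y ⬝ᵥ V.mulVec (wr y)) := by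
    intro x y
    refine sq_le_of_forall_mul_le fun s t => ?_
    have := PosSemidef.dotProduct_le hV (s • wl x) (t • wr y)
    simp only [Matrix.mulVec_smul, dotProduct_smul, smul_dotProduct, smul_eq_mul, hO, hO'] at this
    linarith
  -- Position and momentum along the same unit vector have variance product at least `ℏ²/4`, so
  -- neither variance can vanish although `V` is only positive semidefinite.
  have hpos : ∀ x : Space n, ‖x‖ = 1 →
      0 < wl x ⬝ᵥ V.mulVec (wl x) ∧ 0 < wr x ⬝ᵥ V.mulVec (wr x) := by
    intro x hx
    have h := hunc x x
    rw [real_inner_self_eq_norm_sq, hx] at h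
    have h1 := hnn (wl x)
    have h2 := hnn (wr x)
    have h3 : 0 < ℏ ^ 2 := by positivity
    constructor
    · refine h1.lt_of_ne fun h0 => ?_
      rw [← h0] at h; nlinarith
    · refine h2.lt_of_ne fun h0 => ?_
      rw [← h0] at h; nlinarith
  refine ⟨wl u ⬝ᵥ μ, wr v ⬝ᵥ μ, ⟨_, hnn (wl u)⟩, ⟨_, hnn (wr v)⟩, ?_, ?_, ?_, ?_, hunc u v⟩
  · exact fun h => (hpos u hu).1.ne' (congrArg NNReal.toReal h)
  · exact fun h => (hpos v hv).2.ne' (congrArg NNReal.toReal h)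
  · refine eq_gaussianReal_of_charFun fun t => ?_
    have e : weyl ℏ 0 ((ℏ * t) • u) = weylVec ℏ (-(Omega n ℏ).mulVec (t • wl u)) := by
      rw [weylVec_neg_Omega]
      congr 1
      · ext j; simp [wl]
      · ext j; simp [wl, mul_assoc]
    rw [charFun_position u ℏ hℏ.ne', e, hc]
    simp only [Matrix.mulVec_smul, dotProduct_smul, smul_dotProduct, smul_eq_mul]
    rw [← mul_assoc, ← pow_two]
    rfl
  · refine eq_gaussianReal_of_charFun fun t => ?_
    have e : weyl ℏ (-(ℏ * t) • v) 0 = weylVec ℏ (-(Omega n ℏ).mulVec (t • wr v)) := by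
      rw [weylVec_neg_Omega]
      congr 1
      · ext j; simp [wr, mul_assoc]
      · ext j; simp [wr]
    rw [charFun_momentum v ℏ, e, hc]
    simp only [Matrix.mulVec_smul, dotProduct_smul, smul_dotProduct, smul_eq_mul]
    rw [← mul_assoc, ← pow_two]
    rfl

/-! ### Covariance -/

/-- Passing to quadratic forms replaces operator conjugation by translation of scalar measures,
which characteristic functions can detect. -/
theorem isCovariant_iff {ℏ : ℝ} {u v : Space n} {M : POVM (ℝ × ℝ) (WaveSpace n)} :
    IsCovariant ℏ u v M ↔ ∀ (x p : Space n) (ψ : WaveSpace n), M.vecMeasure (weyl ℏ x p ψ) =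
      (M.vecMeasure ψ).map (fun z => z + (inner ℝ u x, inner ℝ v p)) := by
  have himg : ∀ (c : ℝ × ℝ) (Z : Set (ℝ × ℝ)), (fun z => z + c) '' Z = (fun z => z - c) ⁻¹' Z := by
    intro c Z
    ext z
    exact ⟨by rintro ⟨y, hy, rfl⟩; simpa using hy, fun h => ⟨z - c, h, by simp⟩⟩
  constructor
  · intro h x p ψ
    ext Z hZ
    set c : ℝ × ℝ := (inner ℝ u x, inner ℝ v p)
    have hm : Measurable fun z : ℝ × ℝ => z + c := by fun_prop
    have hcov := h _ (hm hZ) x p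
    rw [Set.image_preimage_eq Z (add_right_surjective c)] at hcov
    rw [POVM.vecMeasure_apply _ _ hZ, Measure.map_apply hm hZ, POVM.vecMeasure_apply _ _ (hm hZ),
      ← hcov, weyl_adjoint]
    congr 2
    change inner ℂ (weyl ℏ x p ψ) (weyl ℏ x p (M.toFun _ (weyl ℏ (-x) (-p) (weyl ℏ x p ψ)))) = _
    rw [weyl_neg_weyl, inner_weyl_weyl]
  · intro h Z hZ x p
    set c : ℝ × ℝ := (inner ℝ u x, inner ℝ v p)
    have hm : Measurable fun z : ℝ × ℝ => z + c := by fun_prop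
    have hZ' : MeasurableSet ((fun z => z + c) '' Z) := by
      rw [himg]; exact (by fun_prop : Measurable fun z : ℝ × ℝ => z - c) hZ
    rw [POVM.toFun_eq_of_vecMeasure M M hZ' hZ (weyl ℏ (-x) (-p)) fun ψ => ?_]
    · rw [weyl_adjoint, weyl_adjoint, neg_neg, neg_neg]
    · conv_lhs => rw [← weyl_weyl_neg ℏ x p ψ]
      rw [h, Measure.map_apply hm hZ', Set.preimage_image_eq _ (add_left_injective c)]

theorem integral_exp_map_add (μ : Measure (ℝ × ℝ)) (c : ℝ × ℝ) (k l : ℝ) :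
    ∫ z : ℝ × ℝ, Complex.exp (Complex.I * ((k * z.1 + l * z.2 : ℝ) : ℂ)) ∂(μ.map fun z => z + c) =
      Complex.exp (Complex.I * ((k * c.1 + l * c.2 : ℝ) : ℂ)) *
        ∫ z : ℝ × ℝ, Complex.exp (Complex.I * ((k * z.1 + l * z.2 : ℝ) : ℂ)) ∂μ := by
  rw [integral_map (by fun_prop) (by fun_prop), ← integral_const_mul]
  refine integral_congr_ae (Filter.Eventually.of_forall fun z => ?_)
  simp only
  rw [← Complex.exp_add]
  congr 1
  push_cast [Prod.fst_add, Prod.snd_add]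
  ring

/-- The translation of the quadratic forms of Weyl operators under conjugation. -/
theorem inner_weyl_weyl_weyl {ℏ : ℝ} (hℏ : ℏ ≠ 0) (x p x' p' : Space n) (ψ : WaveSpace n) :
    inner ℂ (weyl ℏ x p ψ) (weyl ℏ x' p' (weyl ℏ x p ψ)) =
      Complex.exp (Complex.I * (((inner ℝ p' x - inner ℝ p x') / ℏ : ℝ) : ℂ)) *
        inner ℂ ψ (weyl ℏ x' p' ψ) := by
  rw [weyl_weyl_comm hℏ x' p' x p, inner_smul_right, inner_weyl_weyl]

/-- The commutation phase is `exp(i(k u·x + l v·p))`, precisely the factor from translating outcomes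
by `(u·x, v·p)`; the scalar `χ` plays no role. -/
theorem isCovariant_of_hasCharFunAt {ℏ : ℝ} (hℏ : ℏ ≠ 0) {u v : Space n}
    {M : POVM (ℝ × ℝ) (WaveSpace n)} {χ : ℝ → ℝ → ℂ}
    (hM : ∀ k l, M.HasCharFunAt k l (χ k l • weyl ℏ (-((ℏ * l) • v)) ((ℏ * k) • u))) :
    IsCovariant ℏ u v M := by
  refine isCovariant_iff.2 fun x p ψ => ?_
  have : IsFiniteMeasure ((M.vecMeasure ψ).map
    fun z => z + ((inner ℝ u x : ℝ), (inner ℝ v p : ℝ))) := Measure.isFiniteMeasure_map _ _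
  refine POVM.measure_ext_of_integral_exp fun k l => ?_
  rw [integral_exp_map_add, hM, hM, smul_apply, smul_apply, inner_smul_right, inner_smul_right,
    inner_weyl_weyl_weyl hℏ, mul_left_comm]
  congr 4
  simp only [inner_neg_right, real_inner_smul_left, real_inner_smul_right]
  rw [real_inner_comm v p]
  field_simp
  ring

theorem eq_zero_of_forall_exp_eq_one {D : ℝ}
    (h : ∀ s : ℝ, Complex.exp (Complex.I * ((s * D : ℝ) : ℂ)) = 1) : D = 0 := by
  by_contra hD
  have := h (Real.pi / D)
  rw [div_mul_cancel₀ _ hD, mul_comm, Complex.exp_pi_mul_I] at this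
  norm_num at this

theorem nontrivial_of_densityOperator {H : Type*} [NormedAddCommGroup H] [InnerProductSpace ℂ H]
    [CompleteSpace H] (ρ : DensityOperator H) : Nontrivial H := by
  by_contra h
  rw [not_nontrivial_iff_subsingleton] at h
  have h1 := ρ.hasSum_trace
  have h2 : ∀ i, inner ℂ (basis H i) (ρ.op (basis H i)) = 0 := fun i => by
    rw [Subsingleton.elim (basis H i) 0, inner_zero_left]
  simp_rw [h2] at h1
  exact one_ne_zero (h1.unique hasSum_zero)

/-- Conjugation by `W(x, p)` gives a phase linear in `Jᵀ(k, l)`, while covariance prescribes `k u·x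
+ l v·p`. Testing on the standard basis recovers every entry of `J`. -/
theorem HasGaussianParams.eq_covMatrix [Nontrivial (WaveSpace n)] {ℏ : ℝ} (hℏ : ℏ ≠ 0)
    {u v : Space n} {M : POVM (ℝ × ℝ) (WaveSpace n)} (hM : IsCovariant ℏ u v M) {μ : Fin 2 → ℝ}
    {V : Matrix (Fin 2) (Fin 2) ℝ} {J : Matrix (Fin 2) (Fin n ⊕ Fin n) ℝ}
    (h : HasGaussianParams ℏ M μ V J) : J = covMatrix u v := by
  have hcov := isCovariant_iff.1 hM
  have key : ∀ (k l : ℝ) (x p : Space n),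
      inner ℝ (WithLp.toLp 2 fun j => J.transpose.mulVec ![k, l] (Sum.inl j) : Space n) x +
      inner ℝ (WithLp.toLp 2 fun j => J.transpose.mulVec ![k, l] (Sum.inr j) : Space n) p =
      k * inner ℝ u x + l * inner ℝ v p := by
    intro k l x p
    set w := J.transpose.mulVec ![k, l]
    set a : Space n := WithLp.toLp 2 fun j => w (Sum.inl j)
    set b : Space n := WithLp.toLp 2 fun j => w (Sum.inr j)
    -- A nonzero expectation is needed to cancel. If all vanished, the Weyl operator would be zero,
    -- though it is isometric on a nonzero space.
    obtain ⟨φ, hφ⟩ : ∃ φ : WaveSpace n, inner ℂ φ (weyl ℏ (-(ℏ • b)) (ℏ • a) φ) ≠ 0 := by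
      by_contra! hcon
      obtain ⟨φ, hφ⟩ := exists_ne (0 : WaveSpace n)
      have h0 : weyl ℏ (-(ℏ • b)) (ℏ • a) = 0 := by
        refine ContinuousLinearMap.coe_injective
          ((ext_inner_map (weyl ℏ (-(ℏ • b)) (ℏ • a)).toLinearMap 0).1 fun ψ => ?_)
        refine ((inner_eq_zero_symm (𝕜 := ℂ)).1 (hcon ψ)).trans ?_
        simp
      have := norm_weyl ℏ (-(ℏ • b)) (ℏ • a) φ
      rw [h0] at this
      exact hφ (norm_eq_zero.1 (by simpa using this.symm))
    -- Equality of phases holds only modulo `2π`; scaling `(x, p)` by every real `s` removes the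
    -- ambiguity.
    refine sub_eq_zero.1 (eq_zero_of_forall_exp_eq_one fun s => ?_)
    have h1 := h.hasCharFunAt k l (weyl ℏ (s • x) (s • p) φ)
    rw [hcov, integral_exp_map_add, h.hasCharFunAt k l φ, weylVec_neg_Omega, smul_apply,
      smul_apply, inner_smul_right (𝕜 := ℂ) (E := WaveSpace n),
      inner_smul_right (𝕜 := ℂ) (E := WaveSpace n), inner_weyl_weyl_weyl hℏ,
      mul_left_comm] at h1
    have h2 := mul_right_cancel₀ hφ (mul_left_cancel₀ (Complex.exp_ne_zero _) h1)
    have h3 : s * (inner ℝ a x + inner ℝ b p - (k * inner ℝ u x + l * inner ℝ v p)) =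
        (inner ℝ (ℏ • a) (s • x) - inner ℝ (s • p) (-(ℏ • b))) / ℏ -
          (k * inner ℝ u (s • x) + l * inner ℝ v (s • p)) := by
      simp only [inner_neg_right, real_inner_smul_left, real_inner_smul_right]
      rw [real_inner_comm b p]
      field_simp
      ring
    rw [h3, Complex.ofReal_sub, mul_sub, Complex.exp_sub, ← h2, div_self (Complex.exp_ne_zero _)]
  have key' : ∀ (i : Fin 2) (q : Fin n ⊕ Fin n), J i q = covMatrix u v i q := by
    rintro i (j | j)
    · have h0 := key 1 0 (EuclideanSpace.single j 1) 0
      have h1 := key 0 1 (EuclideanSpace.single j 1) 0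
      fin_cases i
      · simpa [covMatrix, Matrix.mulVec, dotProduct, Fin.sum_univ_two,
          EuclideanSpace.inner_single_right] using h0
      · simpa [covMatrix, Matrix.mulVec, dotProduct, Fin.sum_univ_two,
          EuclideanSpace.inner_single_right] using h1
    · have h0 := key 1 0 0 (EuclideanSpace.single j 1)
      have h1 := key 0 1 0 (EuclideanSpace.single j 1)
      fin_cases i
      · simpa [covMatrix, Matrix.mulVec, dotProduct, Fin.sum_univ_two,
          EuclideanSpace.inner_single_right] using h0
      · simpa [covMatrix, Matrix.mulVec, dotProduct, Fin.sum_univ_two,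
          EuclideanSpace.inner_single_right] using h1
  ext i q
  exact key' i q

end

section

variable {n : ℕ}

/-! ### The error function of Gaussian covariant bi-observables -/

/-- The diagonal bounds come from real test vectors, the product bound from the determinant: the
off-diagonal entries are `V 0 1 ± iℏ u·v/2`. -/
theorem HasGaussianParams.noise {ℏ : ℝ} {u v : Space n} {M : POVM (ℝ × ℝ) (WaveSpace n)}
    {μ : Fin 2 → ℝ} {V : Matrix (Fin 2) (Fin 2) ℝ}
    (h : HasGaussianParams ℏ M μ V (covMatrix u v)) :
    0 ≤ V 0 0 ∧ 0 ≤ V 1 1 ∧ (ℏ * inner ℝ u v) ^ 2 / 4 + V 0 1 ^ 2 ≤ V 0 0 * V 1 1 := by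
  have h1 := h.posSemidef_add
  rw [covMatrix_mul_Omega] at h1
  have h2 := PosSemidef.dotProduct_le h1 ![1, 0] 0
  have h3 := PosSemidef.dotProduct_le h1 ![0, 1] 0
  have h4 := h1.det_nonneg
  have h5 : V 1 0 = V 0 1 := h.symm.apply 0 1
  refine ⟨by simpa [Matrix.mulVec, dotProduct, Fin.sum_univ_two] using h2,
    by simpa [Matrix.mulVec, dotProduct, Fin.sum_univ_two] using h3, ?_⟩
  have e : (toComplex V + (Complex.I / 2) •
      toComplex !![0, ℏ * inner ℝ u v; -(ℏ * inner ℝ u v), 0]).det =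
      ((V 0 0 * V 1 1 - V 0 1 ^ 2 - (ℏ * inner ℝ u v) ^ 2 / 4 : ℝ) : ℂ) := by
    rw [Matrix.det_fin_two]
    simp [toComplex, h5]
    ring_nf
    simp
    ring
  rw [e, Complex.zero_le_real] at h4
  linarith

theorem dotProduct_pair (μ : Fin 2 → ℝ) (V : Matrix (Fin 2) (Fin 2) ℝ) (k l : ℝ) :
    ![k, l] ⬝ᵥ μ = k * μ 0 + l * μ 1 ∧ ![k, l] ⬝ᵥ V.mulVec ![k, l] =
      k ^ 2 * V 0 0 + k * l * (V 0 1 + V 1 0) + l ^ 2 * V 1 1 := by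
  constructor
  · simp [dotProduct, Fin.sum_univ_two]
  · simp [Matrix.mulVec, dotProduct, Fin.sum_univ_two]
    ring

/-- Setting `l = 0` or `k = 0` makes the Weyl operator the one of sharp position or momentum, so
each marginal is the sharp law convolved with a Gaussian. The off-diagonal noise drops out. -/
theorem HasGaussianParams.errorFunction_eq {ℏ : ℝ} (hℏ : ℏ ≠ 0) {u v : Space n}
    {ρ : DensityOperator (WaveSpace n)} {m₁ m₂ : ℝ} {A B : NNReal} (hA : A ≠ 0) (hB : B ≠ 0)
    (hQ : (positionPVM u).dist ρ = gaussianReal m₁ A)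
    (hP : (momentumPVM ℏ v).dist ρ = gaussianReal m₂ B) {M : POVM (ℝ × ℝ) (WaveSpace n)}
    {μ : Fin 2 → ℝ} {V : Matrix (Fin 2) (Fin 2) ℝ}
    (h : HasGaussianParams ℏ M μ V (covMatrix u v)) :
    errorFunction ℏ u v ρ M = ENNReal.ofReal (logE / 2 * (sFun (V 0 0 / A) + sFun (V 1 1 / B) +
      (μ 0 ^ 2 / (A + V 0 0) + μ 1 ^ 2 / (B + V 1 1)))) := by
  obtain ⟨h0, h1, -⟩ := h.noise
  lift V 0 0 to NNReal using h0 with a ha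
  lift V 1 1 to NNReal using h1 with b hb
  have hT := h.hasCharFunAt
  simp only [weylVec_covMatrix] at hT
  have e1 : M.fst.dist ρ = gaussianReal (m₁ + μ 0) (A + a) := by
    refine eq_gaussianReal_of_charFun fun t => ?_
    have hc := charFun_position u ℏ hℏ ρ t
    rw [hQ, charFun_gaussianReal] at hc
    rw [M.charFun_fst ρ hT, trace_mul_smul, (dotProduct_pair μ V t 0).1, (dotProduct_pair μ V t 0).2]
    simp only [mul_zero, zero_smul, neg_zero]
    rw [← hc, ← Complex.exp_add, ← ha]
    congr 1
    push_cast
    ring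
  have e2 : M.snd.dist ρ = gaussianReal (m₂ + μ 1) (B + b) := by
    refine eq_gaussianReal_of_charFun fun t => ?_
    have hc := charFun_momentum v ℏ ρ t
    rw [hP, charFun_gaussianReal] at hc
    rw [M.charFun_snd ρ hT, trace_mul_smul, (dotProduct_pair μ V 0 t).1, (dotProduct_pair μ V 0 t).2]
    simp only [mul_zero, zero_smul, ← neg_smul]
    rw [← hc, ← Complex.exp_add, ← hb]
    congr 1
    push_cast
    ring
  have hE := logE_pos
  rw [errorFunction, hQ, hP, e1, e2, relEntropy_gaussianReal _ _ hA, relEntropy_gaussianReal _ _ hB,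
    ← ENNReal.ofReal_add]
  · congr 1
    ring
  · have := sFun_nonneg (show (0 : ℝ) ≤ a / A by positivity)
    positivity
  · have := sFun_nonneg (show (0 : ℝ) ≤ b / B by positivity)
    positivity

/-- The lower bound for the error function, and the characterization of its minimum. -/
theorem HasGaussianParams.le_errorFunction {ℏ : ℝ} (hℏ : ℏ ≠ 0) {u v : Space n}
    {ρ : DensityOperator (WaveSpace n)} {m₁ m₂ : ℝ} {A B : NNReal} (hA : A ≠ 0) (hB : B ≠ 0)
    (hQ : (positionPVM u).dist ρ = gaussianReal m₁ A)
    (hP : (momentumPVM ℏ v).dist ρ = gaussianReal m₂ B) {M : POVM (ℝ × ℝ) (WaveSpace n)}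
    {μ : Fin 2 → ℝ} {V : Matrix (Fin 2) (Fin 2) ℝ}
    (h : HasGaussianParams ℏ M μ V (covMatrix u v)) {z : ℝ} (hz : 0 ≤ z)
    (hzAB : z ^ 2 * (A * B) = (ℏ * inner ℝ u v) ^ 2 / 4) :
    ENNReal.ofReal (sFun z * logE) ≤ errorFunction ℏ u v ρ M ∧
      (errorFunction ℏ u v ρ M = ENNReal.ofReal (sFun z * logE) ↔
        μ = 0 ∧ V 0 1 = 0 ∧ V 0 0 = z * A ∧ V 1 1 = z * B) := by
  obtain ⟨h0, h1, h01⟩ := h.noise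
  have pA : (0 : ℝ) < A := by positivity
  have pB : (0 : ℝ) < B := by positivity
  have hE := logE_pos
  have hxy : z ^ 2 ≤ V 0 0 / A * (V 1 1 / B) := by
    rw [div_mul_div_comm, le_div_iff₀ (by positivity), hzAB]
    nlinarith [sq_nonneg (V 0 1)]
  obtain ⟨hle, heq⟩ := two_mul_sFun_le (div_nonneg h0 pA.le) (div_nonneg h1 pB.le) hz hxy
  have d0 : 0 ≤ μ 0 ^ 2 / (A + V 0 0) := by positivity
  have d1 : 0 ≤ μ 1 ^ 2 / (B + V 1 1) := by positivity
  rw [h.errorFunction_eq hℏ hA hB hQ hP]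
  refine ⟨ENNReal.ofReal_le_ofReal (by nlinarith), ?_⟩
  have hs := sFun_nonneg hz
  rw [ENNReal.ofReal_eq_ofReal_iff (mul_nonneg (by positivity) (by linarith)) (by positivity)]
  constructor
  · intro he
    have he' : sFun (V 0 0 / A) + sFun (V 1 1 / B) +
        (μ 0 ^ 2 / (A + V 0 0) + μ 1 ^ 2 / (B + V 1 1)) = 2 * sFun z := by
      have : logE * (sFun (V 0 0 / A) + sFun (V 1 1 / B) +
        (μ 0 ^ 2 / (A + V 0 0) + μ 1 ^ 2 / (B + V 1 1))) = logE * (2 * sFun z) := by linarith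
      exact mul_left_cancel₀ hE.ne' this
    obtain ⟨x1, x2⟩ := heq (by linarith)
    have z0 : μ 0 ^ 2 / (A + V 0 0) = 0 := by linarith
    have z1 : μ 1 ^ 2 / (B + V 1 1) = 0 := by linarith
    have v0 : V 0 0 = z * A := (div_eq_iff pA.ne').1 x1
    have v1 : V 1 1 = z * B := (div_eq_iff pB.ne').1 x2
    refine ⟨?_, ?_, v0, v1⟩
    · have y0 : μ 0 = 0 := by
        rcases div_eq_zero_iff.1 z0 with h | h
        · exact pow_eq_zero_iff two_ne_zero |>.1 h
        · linarith
      have y1 : μ 1 = 0 := by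
        rcases div_eq_zero_iff.1 z1 with h | h
        · exact pow_eq_zero_iff two_ne_zero |>.1 h
        · linarith
      ext i
      fin_cases i <;> assumption
    -- The diagonal entries already saturate the determinant inequality, leaving no room for `V 0
    -- 1`.
    · rw [v0, v1, ← hzAB] at h01
      have : V 0 1 ^ 2 ≤ 0 := by nlinarith
      exact pow_eq_zero_iff two_ne_zero |>.1 (le_antisymm this (sq_nonneg _))
  · rintro ⟨rfl, -, v0, v1⟩
    rw [v0, v1, mul_div_cancel_right₀ _ pA.ne', mul_div_cancel_right₀ _ pB.ne']
    simp
    ring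

/-! ### The optimal bi-observable -/

/-- The matrix is `w w*` for `w = (p, q ε̄)`. With `ε = ±i` it is the minimal noise matrix, whose
determinant is zero. -/
theorem posSemidef_rank_one (p q : ℝ) (ε : ℂ) (hε : ε * star ε = 1) :
    (!![(p : ℂ) * p, p * q * ε; p * q * star ε, (q : ℂ) * q]).PosSemidef := by
  have h := Matrix.posSemidef_vecMulVec_self_star ![(p : ℂ), q * star ε]
  convert h using 1
  ext i j
  fin_cases i <;> fin_cases j <;> simp [Matrix.vecMulVec]
  · ring
  · ring
  · have : (starRingEnd ℂ) ε * ε = 1 := by rw [mul_comm]; exact hε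
    linear_combination (-(q : ℂ) * q) * this

/-- Square roots only give `|d|/2`, so the sign of `d` is put into `q`. -/
theorem exists_noise_amplitudes {a b d : ℝ} (ha : 0 ≤ a) (hb : 0 ≤ b) (h : a * b = d ^ 2 / 4) :
    ∃ p q : ℝ, p * p = a ∧ q * q = b ∧ p * q = d / 2 := by
  have hs : √a * √b = |d| / 2 := by
    rw [← Real.sqrt_mul ha, h, show d ^ 2 / 4 = (d / 2) ^ 2 by ring, Real.sqrt_sq_eq_abs, abs_div,
      abs_two]
  rcases le_total 0 d with hd | hd
  · exact ⟨√a, √b, Real.mul_self_sqrt ha, Real.mul_self_sqrt hb, by rw [hs, abs_of_nonneg hd]⟩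
  · exact ⟨√a, -√b, Real.mul_self_sqrt ha, by rw [neg_mul_neg, Real.mul_self_sqrt hb], by
      rw [mul_neg, hs, abs_of_nonpos hd]; ring⟩

theorem exists_gaussianCovariant {ℏ : ℝ} (hℏ : ℏ ≠ 0) {u v : Space n} (hv : v ≠ 0) {a b : ℝ}
    (ha : 0 ≤ a) (hb : 0 ≤ b) (hab : a * b = (ℏ * inner ℝ u v) ^ 2 / 4) :
    ∃ M ∈ GaussianCovariant ℏ u v, HasGaussianParams ℏ M 0 !![a, 0; 0, b] (covMatrix u v) := by
  obtain ⟨p, q, rfl, rfl, hpq⟩ := exists_noise_amplitudes ha hb hab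
  -- With `b = -2q/ℏ` the momentum noise `ℏ² b²/4` is `q²`, and `p q = ℏ u·v/2` becomes the
  -- orthogonality condition.
  have hchar := hasCharFunAt_smearedPOVM hℏ (u := u) hv (a := p) (b := -(2 * q / ℏ))
    (by rw [mul_neg, neg_inj, mul_div_assoc', div_eq_iff hℏ]; linarith)
  have hpqC : (p : ℂ) * q = ((ℏ * inner ℝ u v : ℝ) : ℂ) / 2 := by
    rw [← Complex.ofReal_mul, hpq]; push_cast; ring
  have hpar : HasGaussianParams ℏ (smearedPOVM ℏ u v p (-(2 * q / ℏ))) 0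
      !![p * p, 0; 0, q * q] (covMatrix u v) := by
    refine ⟨?_, ?_, ?_, fun k l => ?_⟩
    · ext i j
      fin_cases i <;> fin_cases j <;> simp
    · rw [covMatrix_mul_Omega]
      convert posSemidef_rank_one p q Complex.I (by simp) using 1
      ext i j
      fin_cases i <;> fin_cases j <;> simp [toComplex, hpqC] <;> ring
    · rw [covMatrix_mul_Omega]
      convert posSemidef_rank_one p q (-Complex.I) (by simp) using 1
      ext i j
      fin_cases i <;> fin_cases j <;> simp [toComplex, hpqC] <;> ring
    · rw [weylVec_covMatrix, (dotProduct_pair 0 !![p * p, 0; 0, q * q] k l).1,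
        (dotProduct_pair 0 !![p * p, 0; 0, q * q] k l).2]
      convert hchar k l using 3
      have : ℏ ^ 2 * (-(2 * q / ℏ)) ^ 2 / 4 = q * q := by field_simp; ring
      rw [this]
      simp
      ring
  exact ⟨_, ⟨isCovariant_of_hasCharFunAt hℏ hchar, _, _, _, hpar⟩, hpar⟩

end

end MUR

end

/-! ### The bound, its minimizer and uniqueness. -/

theorem mainTheorem3 {n : ℕ} (ℏ : ℝ) (hℏ : 0 < ℏ) (u v : Space n) (hu : ‖u‖ = 1) (hv : ‖v‖ = 1)
    (α : ℝ) (hα : inner ℝ u v = Real.cos α)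
    (ρ : DensityOperator (WaveSpace n)) (hρ : IsGaussianState ℏ ρ) :
    -- the variances are positive and `z_ρ ∈ [0, 1]`
    (0 < varQ u ρ ∧ 0 < varP ℏ v ρ ∧ 0 ≤ zRho ℏ u v α ρ ∧ zRho ℏ u v α ρ ≤ 1) ∧
    -- the explicit form of the lower bound
    cRho ℏ u v α ρ = logE * (Real.log (1 + ℏ * |Real.cos α| / (2 * √(varQ u ρ * varP ℏ v ρ)))
      - ℏ * |Real.cos α| / (ℏ * |Real.cos α| + 2 * √(varQ u ρ * varP ℏ v ρ))) ∧
    -- the lower bound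
    (∀ M ∈ GaussianCovariant ℏ u v,
      relEntropy ((positionPVM u).dist ρ) (M.fst.dist ρ) +
        relEntropy ((momentumPVM ℏ v).dist ρ) (M.snd.dist ρ) ≥ ENNReal.ofReal (cRho ℏ u v α ρ)) ∧
    -- the bound is attained, by a unique bi-observable, whose parameters are as stated
    (∃ Mstar ∈ GaussianCovariant ℏ u v,
      errorFunction ℏ u v ρ Mstar = ENNReal.ofReal (cRho ℏ u v α ρ) ∧
      (∀ M ∈ GaussianCovariant ℏ u v,
        errorFunction ℏ u v ρ M = ENNReal.ofReal (cRho ℏ u v α ρ) → M = Mstar) ∧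
      HasGaussianParams ℏ Mstar 0
        !![zRho ℏ u v α ρ * varQ u ρ, 0; 0, zRho ℏ u v α ρ * varP ℏ v ρ] (covMatrix u v)) ∧
    -- the optimal bi-observable is characterized by its parameters
    (∀ M ∈ GaussianCovariant ℏ u v, ∀ μ V J, HasGaussianParams ℏ M μ V J →
      (errorFunction ℏ u v ρ M = ENNReal.ofReal (cRho ℏ u v α ρ) ↔
        μ = 0 ∧ V 0 1 = 0 ∧ V 0 0 = zRho ℏ u v α ρ * varQ u ρ ∧
          V 1 1 = zRho ℏ u v α ρ * varP ℏ v ρ)) ∧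
    -- the explicit form of the optimal variances
    zRho ℏ u v α ρ * varQ u ρ = ℏ / 2 * √(varQ u ρ / varP ℏ v ρ) * |Real.cos α| ∧
    zRho ℏ u v α ρ * varP ℏ v ρ = ℏ / 2 * √(varP ℏ v ρ / varQ u ρ) * |Real.cos α| := by
  obtain ⟨m₁, m₂, A, B, hA, hB, hQ, hP, hAB⟩ := hρ.exists_gaussianReal hℏ hu hv
  have pA : (0 : ℝ) < A := by positivity
  have pB : (0 : ℝ) < B := by positivity
  have hvQ : varQ u ρ = A := by rw [varQ, hQ, variance_id_gaussianReal]
  have hvP : varP ℏ v ρ = B := by rw [varP, hP, variance_id_gaussianReal]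
  have hc := abs_nonneg (Real.cos α)
  have hsqrt : 0 < √((A : ℝ) * B) := Real.sqrt_pos.2 (by positivity)
  have hz0 : 0 ≤ zRho ℏ u v α ρ := by rw [zRho]; positivity
  have hz2 : zRho ℏ u v α ρ ^ 2 * (A * B) = (ℏ * inner ℝ u v) ^ 2 / 4 := by
    rw [zRho, hvQ, hvP, div_pow, mul_pow, mul_pow, sq_abs, Real.sq_sqrt (by positivity), hα]
    field_simp
    ring
  -- This is the uncertainty relation `hAB` of the state itself.
  have hz1 : zRho ℏ u v α ρ ≤ 1 := by
    refine (sq_le_one_iff₀ hz0).1 ?_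
    have : zRho ℏ u v α ρ ^ 2 * (A * B) ≤ 1 * (A * B) := by rw [hz2]; linarith
    exact le_of_mul_le_mul_right this (by positivity)
  have hv0 : v ≠ 0 := by rintro rfl; simp at hv
  have := nontrivial_of_densityOperator ρ
  have hJ : ∀ M ∈ GaussianCovariant ℏ u v, ∀ μ V J, HasGaussianParams ℏ M μ V J →
      HasGaussianParams ℏ M μ V (covMatrix u v) := by
    intro M hM μ V J h
    have hJ := h.eq_covMatrix hℏ.ne' hM.1
    rwa [← hJ]
  have hmin : ∀ M ∈ GaussianCovariant ℏ u v, ∀ μ V J, HasGaussianParams ℏ M μ V J →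
      _ := fun M hM μ V J h =>
    (hJ M hM μ V J h).le_errorFunction hℏ.ne' hA hB hQ hP hz0 hz2
  -- The variances `z A` and `z B` have product `(ℏ u·v)²/4`, the least the noise inequality allows.
  obtain ⟨Mstar, hMstar, hpar⟩ := exists_gaussianCovariant hℏ.ne' hv0 (u := u)
    (mul_nonneg hz0 pA.le) (mul_nonneg hz0 pB.le) (by rw [← hz2]; ring)
  have hroot : ∀ x y : ℝ, 0 < x → 0 < y → x / √(x * y) = √(x / y) := by
    intro x y hx hy
    rw [Real.sqrt_mul hx.le, Real.sqrt_div hx.le, ← div_div, Real.div_sqrt]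
  refine ⟨⟨hvQ ▸ pA, hvP ▸ pB, hz0, hz1⟩, ?_, ?_, ⟨Mstar, hMstar, ?_, ?_, ?_⟩, ?_, ?_, ?_⟩
  · rw [cRho, sFun, zRho, hvQ, hvP, mul_comm logE]
    congr 2
    field_simp
    ring
  · intro M hM
    obtain ⟨μ, V, J, h⟩ := hM.2
    exact (hmin M hM μ V J h).1
  · exact (hmin Mstar hMstar _ _ _ hpar).2.2 ⟨rfl, by simp, by simp, by simp⟩
  · intro M hM he
    obtain ⟨μ, V, J, h⟩ := hM.2
    obtain ⟨rfl, v01, v00, v11⟩ := (hmin M hM μ V J h).2.1 he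
    have h' := hJ M hM _ _ _ h
    have hV : V = !![zRho ℏ u v α ρ * A, 0; 0, zRho ℏ u v α ρ * B] := by
      have v10 : V 1 0 = 0 := (h.symm.apply 0 1).trans v01
      ext i j
      fin_cases i <;> fin_cases j <;> simp [v01, v00, v11, v10]
    rw [hV] at h'
    exact POVM.ext_of_hasCharFunAt h'.hasCharFunAt hpar.hasCharFunAt
  · rw [hvQ, hvP]
    exact hpar
  · intro M hM μ V J h
    rw [hvQ, hvP]
    exact (hmin M hM μ V J h).2
  · rw [zRho, hvQ, hvP, ← hroot _ _ pA pB]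
    field_simp
  · rw [zRho, hvQ, hvP, ← hroot _ _ pB pA, mul_comm (B : ℝ) A]
    field_simp
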